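/- Let $H_1,H_2$ be real Hilbert spaces and $A:H_1\to H_2$ a bounded linear operator with adjoint $A^*$. Let $e_1:H_1\to\mathbb R\cup\{+\infty\}$ and $g_1:H_2\to\mathbb R\cup\{+\infty\}$ be proper, lower semicontinuous and convex, and let $e_2:H_1\to\mathbb R$ and $g_2:H_2\to\mathbb R$ be convex and (Fréchet) differentiable, with gradients $\nabla e_2,\nabla g_2$ that are Lipschitz continuous with constants $L_1>0$ and $L_2>0$, respectively. Let $$\Omega=\{x\in H_1:\ x \text{ minimizes } e_1+e_2 \text{ over } H_1 \text{ and } Ax \text{ minimizes } g_1+g_2 \text{ over } H_2\}$$ be the solution set of the split convex minimization problem, and assume $\Omega\neq\emptyset$. Let $F:H_1\to H_1$ be Lipschitz continuous and $\gamma$-strongly monotone for some $\gamma>0$, that is, $\langle F(x)-F(y),x-y\rangle\ge\gamma\|x-y\|^2$ for all $x,y\in H_1$. Let $(\alpha_n)_{n\ge1}$ and $(\lambda_n)_{n\ge1}$ be real sequences such that (C1) $\alpha_n\in(0,1)$, $\lim_{n\to\infty}\alpha_n=0$ and $\sum_{n=1}^\infty\alpha_n=\infty$; (C2) $\lim_{n\to\infty}|\alpha_{n+1}-\alpha_n|/\alpha_n^2=0$;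 (C3) for some constants $c>0$ and $\rho>2$, $\;c<\lambda_n<\frac1\rho\min\left\{\frac1{L_1},\frac1{L_2},\frac1{\|A\|^2}\right\}$ for all $n$ (with $1/\|A\|^2=+\infty$ if $A=0$). For a function $e$ let $\partial e(x)=\{u:\ e(y)\ge e(x)+\langle u,y-x\rangle\ \ \forall y\}$ be its subdifferential, and for $\lambda>0$ let $J_\lambda^{\partial e}=(I+\lambda\,\partial e)^{-1}$ be the resolvent. Then $J^{\partial e_1}_{\lambda_n}$ and $J^{\partial g_1}_{\lambda_n}$ are single-valued and defined everywhere, and for every $z_1\in H_1$ the sequence defined by $$z_{n+1}=J^{\partial e_1}_{\lambda_n}\Big(z_n-\lambda_n\nabla e_2(z_n)-\lambda_nA^*\big(I-J^{\partial g_1}_{\lambda_n}(I-\lambda_n\nabla g_2)\big)Az_n-\lambda_n\alpha_nF(z_n)\Big),\qquad n\ge1,$$ converges strongly to a point $u\in\Omega$, and $u$ is the unique element of $\Omega$ with $\langle F(u),x-u\rangle\ge0$ for all $x\in\Omega$. -/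

import Mathlib

open Filter Topology
open scoped InnerProductSpace Gradient NNReal

namespace SplitMin

section

variable {H : Type*} [NormedAddCommGroup H] [InnerProductSpace ℝ H]

/-- A function `e : H → ℝ ∪ {+∞}` that is proper, lower semicontinuous and convex. It takes values
in `EReal`, and the value `-∞` is excluded. -/
structure IsProperLscConvex (e : H → EReal) : Prop where
  ne_bot : ∀ x, e x ≠ ⊥
  exists_ne_top : ∃ x, e x ≠ ⊤
  lsc : LowerSemicontinuous e
  convex : ∀ x y : H, ∀ a b : ℝ, 0 < a → 0 < b → a + b = 1 →
    e (a • x + b • y) ≤ (a : EReal) * e x + (b : EReal) * e y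

/-- The subdifferential of `e` at `x`. -/
def subdifferential (e : H → EReal) (x : H) : Set H :=
  {u | ∀ y, e x + ((⟪u, y - x⟫_ℝ : ℝ) : EReal) ≤ e y}

/-- `p` belongs to `(I + r B)⁻¹ x`, that is, `x ∈ p + r B p`. -/
def IsResolventPoint (B : H → Set H) (r : ℝ) (x p : H) : Prop :=
  ∃ b ∈ B p, p + r • b = x

open Classical in
/-- The resolvent `(I + r B)⁻¹` as a single-valued map: the point of `(I + r B)⁻¹ x` if that set
is nonempty, and `0` otherwise. -/
noncomputable def resolventMap (B : H → Set H) (r : ℝ) (x : H) : H :=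
  if h : ∃ p, IsResolventPoint B r x p then h.choose else 0

/-- `F` is `γ`-strongly monotone. -/
def IsStronglyMonotone (F : H → H) (γ : ℝ) : Prop :=
  0 < γ ∧ ∀ x y, γ * ‖x - y‖ ^ 2 ≤ ⟪F x - F y, x - y⟫_ℝ

end

section

variable {H₁ H₂ : Type*}
  [NormedAddCommGroup H₁] [InnerProductSpace ℝ H₁]
  [NormedAddCommGroup H₂] [InnerProductSpace ℝ H₂]

/-- The solutions of the split convex minimization problem: the points `x` that minimize
`e₁ + e₂` over `H₁` and whose image `A x` minimizes `g₁ + g₂` over `H₂`. -/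
def solutionSet (A : H₁ →L[ℝ] H₂) (e₁ : H₁ → EReal) (e₂ : H₁ → ℝ)
    (g₁ : H₂ → EReal) (g₂ : H₂ → ℝ) : Set H₁ :=
  {x | (∀ x', e₁ x + (e₂ x : EReal) ≤ e₁ x' + (e₂ x' : EReal)) ∧
    ∀ y', g₁ (A x) + (g₂ (A x) : EReal) ≤ g₁ y' + (g₂ y' : EReal)}

/-- One step of the regularized proximal-gradient iteration, with step size `r` and
regularization parameter `a`, from the point `z`. -/
noncomputable def step [CompleteSpace H₁] [CompleteSpace H₂]
    (A : H₁ →L[ℝ] H₂) (e₁ : H₁ → EReal) (e₂ : H₁ → ℝ)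
    (g₁ : H₂ → EReal) (g₂ : H₂ → ℝ) (F : H₁ → H₁) (r a : ℝ) (z : H₁) : H₁ :=
  resolventMap (subdifferential e₁) r
    (z - r • ∇ e₂ z
      - r • ContinuousLinearMap.adjoint A
          (A z - resolventMap (subdifferential g₁) r (A z - r • ∇ g₂ (A z)))
      - (r * a) • F z)

end

end SplitMin

/-!
Write `B z = ∇e₂ z + A* (I - T) A z`, where `T = (I + r ∂g₁)⁻¹ (I - r ∇g₂)`, so that one iteration
is a forward step along `B + a F` followed by the resolvent of `∂e₁`. The operators `T` and `B`
depend on the step size `r`, which varies along the iteration, but every solution is a fixed point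
of the unregularized step for each `r`.

By the Baillon–Haddad theorem (`gradient_cocoercive`) and the firm nonexpansiveness of resolvents,
for small `r` the forward step contracts squared distances to a solution `u` by the factor
`1 - r a γ`, up to the perturbation `r a F u`, and decreases them further by multiples of
`‖∇e₂ z - ∇e₂ u‖²` and `‖(I - T) A z‖²` (`norm_sq_forward_le`); the backward step gains one more
square (`step_sub_norm_sq_le`). Let `u` be the solution of the variational inequality, which exists
because the solution set is closed and convex and `F` is strongly monotone and Lipschitz. Then
`s n = ‖z n - u‖²` eventually satisfies
`s (n + 1) + η n ≤ (1 - t n) s n - (2 / γ) t n ⟪F u, Y n⟫`, with `t n = r n a n γ`, `η n ≥ 0` the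
sum of the gains, and `Y n` the bounded deviation of the explicit part from the one at `u`.

It suffices that the last term minus `η n` is eventually at most `ε t n` for each `ε > 0`
(`tendsto_zero_of_recursive_le`). Where this fails, `η n = O(t n)`. If it fails infinitely often,
the gains vanish along an ultrafilter, the demiclosedness principle (`isMinimizer_of_weak_limit`)
shows that the weak limit `w` of the iterates is a solution, and `⟪F u, Y n⟫` tends to
`⟪F u, w - u⟫ ≥ 0`, a contradiction.

Resolvents are constructed by minimizing `e + ‖· - x‖² / (2 r)` (`IsProperLscConvex.exists_prox`).
-/

namespace SplitMin

/-! ### Smooth convex functions -/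

section Smooth

variable {H : Type*} [NormedAddCommGroup H] [InnerProductSpace ℝ H] [CompleteSpace H]

lemma hasDerivAt_comp_add_smul {f : H → ℝ} {g x d : H} {t : ℝ}
    (hf : HasGradientAt f g (x + t • d)) :
    HasDerivAt (fun s : ℝ => f (x + s • d)) ⟪g, d⟫_ℝ t := by
  have h1 : HasDerivAt (fun s : ℝ => x + s • d) d t := by
    simpa using ((hasDerivAt_id t).smul_const d).const_add x
  have h2 := hf.hasFDerivAt.comp_hasDerivAt t h1
  exact h2.congr_deriv (by simp)

/-- The one-sided difference quotients along a line converge to the directional derivative. -/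
lemma tendsto_lineQuotient_inner {f : H → ℝ} {g x : H} (hf : HasGradientAt f g x) (d : H) :
    Tendsto (fun t : ℝ => t⁻¹ * (f (x + t • d) - f x)) (𝓝[>] 0) (𝓝 ⟪g, d⟫_ℝ) := by
  have h := (hasDerivAt_comp_add_smul (t := 0) (d := d)
    (by simpa using hf)).tendsto_slope_zero_right
  simpa using h

lemma inner_gradient_le_of_line {f : H → ℝ} {g x d : H} {C : ℝ} (hf : HasGradientAt f g x)
    (h : ∀ t : ℝ, 0 < t → t < 1 → f (x + t • d) - f x ≤ t * C) : ⟪g, d⟫_ℝ ≤ C := by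
  refine le_of_tendsto (tendsto_lineQuotient_inner hf d) ?_
  filter_upwards [Ioo_mem_nhdsGT (zero_lt_one' ℝ)] with t ht
  rw [inv_mul_le_iff₀ ht.1]
  exact h t ht.1 ht.2

lemma le_inner_gradient_of_line {f : H → ℝ} {g x d : H} {C : ℝ} (hf : HasGradientAt f g x)
    (h : ∀ t : ℝ, 0 < t → t < 1 → t * C ≤ f (x + t • d) - f x) : C ≤ ⟪g, d⟫_ℝ := by
  refine ge_of_tendsto (tendsto_lineQuotient_inner hf d) ?_
  filter_upwards [Ioo_mem_nhdsGT (zero_lt_one' ℝ)] with t ht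
  rw [le_inv_mul_iff₀ ht.1]
  exact h t ht.1 ht.2

lemma add_inner_gradient_le {f : H → ℝ} (hc : ConvexOn ℝ Set.univ f) (hd : Differentiable ℝ f)
    (x y : H) : f x + ⟪∇ f x, y - x⟫_ℝ ≤ f y := by
  have := inner_gradient_le_of_line (hd x).hasGradientAt (d := y - x) (C := f y - f x) ?_
  · linarith
  intro t h0 h1
  have h := hc.2 (Set.mem_univ x) (Set.mem_univ y) (sub_nonneg.2 h1.le) h0.le (by ring)
  have e : x + t • (y - x) = (1 - t) • x + t • y := by module
  rw [e]
  simp only [smul_eq_mul] at h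
  linarith

/-- The descent lemma: a function with `L`-Lipschitz gradient lies below its quadratic model. -/
lemma le_add_inner_gradient_add_sq {f : H → ℝ} (hd : Differentiable ℝ f) {L : ℝ≥0}
    (hL : LipschitzWith L (∇ f)) (x y : H) :
    f y ≤ f x + ⟪∇ f x, y - x⟫_ℝ + L / 2 * ‖y - x‖ ^ 2 := by
  set d := y - x with hdd
  have hder : ∀ t : ℝ, HasDerivAt
      (fun s : ℝ => f (x + s • d) - s * ⟪∇ f x, d⟫_ℝ - L / 2 * ‖d‖ ^ 2 * s ^ 2)
      (⟪∇ f (x + t • d), d⟫_ℝ - ⟪∇ f x, d⟫_ℝ - L * ‖d‖ ^ 2 * t) t := by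
    intro t
    have h1 := hasDerivAt_comp_add_smul (hd (x + t • d)).hasGradientAt
    have h2 := (hasDerivAt_id t).mul_const ⟪∇ f x, d⟫_ℝ
    have h3 := ((hasDerivAt_id t).pow 2).const_mul ((L : ℝ) / 2 * ‖d‖ ^ 2)
    refine ((h1.sub h2).sub h3).congr_deriv ?_
    simp
    ring
  have hanti := antitoneOn_of_deriv_nonpos (convex_Icc (0 : ℝ) 1)
    (fun t _ => (hder t).continuousAt.continuousWithinAt)
    (fun t _ => (hder t).differentiableAt.differentiableWithinAt) (by
      intro t ht
      rw [interior_Icc] at ht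
      rw [(hder t).deriv, ← inner_sub_left]
      have h1 := real_inner_le_norm (∇ f (x + t • d) - ∇ f x) d
      have h2 : ‖∇ f (x + t • d) - ∇ f x‖ ≤ L * (t * ‖d‖) := by
        have := hL.norm_sub_le (x + t • d) x
        rwa [add_sub_cancel_left, norm_smul, Real.norm_of_nonneg ht.1.le] at this
      nlinarith [norm_nonneg d])
  have := hanti (Set.left_mem_Icc.2 zero_le_one) (Set.right_mem_Icc.2 zero_le_one) zero_le_one
  simp only [zero_smul, one_smul, add_zero, hdd, add_sub_cancel] at this
  simp only [hdd]
  linarith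

/-- One half of the Baillon–Haddad theorem: the convexity inequality sharpened by the gradient
difference. The lower bound at `x` and the descent lemma at `y` are compared at the point
`y - L⁻¹ (∇ f y - ∇ f x)`. -/
lemma add_inner_gradient_add_sq_le {f : H → ℝ} (hc : ConvexOn ℝ Set.univ f)
    (hd : Differentiable ℝ f) {L : ℝ≥0} (hL0 : 0 < L) (hL : LipschitzWith L (∇ f)) (x y : H) :
    f x + ⟪∇ f x, y - x⟫_ℝ + 1 / (2 * L) * ‖∇ f y - ∇ f x‖ ^ 2 ≤ f y := by
  have hL0' : (0 : ℝ) < L := hL0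
  set h := ∇ f y - ∇ f x with hh
  have h1 := add_inner_gradient_le hc hd x (y - (L : ℝ)⁻¹ • h)
  have h2 := le_add_inner_gradient_add_sq hd hL y (y - (L : ℝ)⁻¹ • h)
  rw [sub_sub_cancel_left, norm_neg, norm_smul, inner_neg_right, real_inner_smul_right,
    Real.norm_of_nonneg (by positivity)] at h2
  rw [sub_right_comm, inner_sub_right, real_inner_smul_right] at h1
  have h3 : ⟪∇ f y, h⟫_ℝ - ⟪∇ f x, h⟫_ℝ = ‖h‖ ^ 2 := by
    rw [← inner_sub_left, ← hh, real_inner_self_eq_norm_sq]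
  have h4 : (L : ℝ)⁻¹ * ⟪∇ f y, h⟫_ℝ - (L : ℝ)⁻¹ * ⟪∇ f x, h⟫_ℝ = (L : ℝ)⁻¹ * ‖h‖ ^ 2 := by
    rw [← mul_sub, h3]
  have h5 : (L : ℝ) / 2 * ((L : ℝ)⁻¹ * ‖h‖) ^ 2 = (L : ℝ)⁻¹ * ‖h‖ ^ 2 / 2 := by
    field_simp
  have h6 : 1 / (2 * (L : ℝ)) * ‖h‖ ^ 2 = (L : ℝ)⁻¹ * ‖h‖ ^ 2 / 2 := by
    field_simp
  linarith

/-- The Baillon–Haddad theorem: an `L`-Lipschitz gradient of a convex function is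
`1 / L`-cocoercive. -/
lemma gradient_cocoercive {f : H → ℝ} (hc : ConvexOn ℝ Set.univ f)
    (hd : Differentiable ℝ f) {L : ℝ≥0} (hL0 : 0 < L) (hL : LipschitzWith L (∇ f)) (x y : H) :
    1 / L * ‖∇ f x - ∇ f y‖ ^ 2 ≤ ⟪∇ f x - ∇ f y, x - y⟫_ℝ := by
  have h1 := add_inner_gradient_add_sq_le hc hd hL0 hL x y
  have h2 := add_inner_gradient_add_sq_le hc hd hL0 hL y x
  rw [norm_sub_rev, ← neg_sub x y, inner_neg_right] at h1
  rw [inner_sub_left]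
  have h6 : 1 / (2 * (L : ℝ)) * ‖∇ f x - ∇ f y‖ ^ 2 = 1 / L * ‖∇ f x - ∇ f y‖ ^ 2 / 2 := by
    field_simp
  linarith

end Smooth

/-! ### Subdifferentials and resolvents -/

section Prox

variable {H : Type*} [NormedAddCommGroup H] [InnerProductSpace ℝ H]

lemma IsProperLscConvex.exists_eq_coe {e : H → EReal} (he : IsProperLscConvex e) {x : H}
    (hx : e x ≠ ⊤) : ∃ r : ℝ, e x = r :=
  ⟨(e x).toReal, (EReal.coe_toReal hx (he.ne_bot x)).symm⟩

lemma IsProperLscConvex.le_coe {e : H → EReal} (he : IsProperLscConvex e) {x y : H} {r s a b : ℝ}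
    (hx : e x ≤ r) (hy : e y ≤ s) (ha : 0 < a) (hb : 0 < b) (hab : a + b = 1) :
    e (a • x + b • y) ≤ ((a * r + b * s : ℝ) : EReal) := by
  refine (he.convex x y a b ha hb hab).trans ?_
  rw [EReal.coe_add, EReal.coe_mul, EReal.coe_mul]
  exact add_le_add (mul_le_mul_of_nonneg_left hx (EReal.coe_nonneg.2 ha.le))
    (mul_le_mul_of_nonneg_left hy (EReal.coe_nonneg.2 hb.le))

lemma IsProperLscConvex.convex_sublevel {e : H → EReal} (he : IsProperLscConvex e) (r : ℝ) :
    Convex ℝ {x | e x ≤ r} := by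
  rw [convex_iff_forall_pos]
  intro x hx y hy a b ha hb hab
  have := he.le_coe hx hy ha hb hab
  rwa [← add_mul, hab, one_mul] at this

/-- A point at which the subdifferential is nonempty has a finite value: otherwise the subgradient
inequality would make the function identically `+∞`. -/
lemma IsProperLscConvex.ne_top_of_mem {e : H → EReal} (he : IsProperLscConvex e) {x u : H}
    (hu : u ∈ subdifferential e x) : e x ≠ ⊤ := by
  obtain ⟨y, hy⟩ := he.exists_ne_top
  intro h
  have := hu y
  rw [h, EReal.top_add_coe] at this
  exact hy (top_le_iff.1 this)

lemma IsProperLscConvex.subdifferential_monotone {e : H → EReal} (he : IsProperLscConvex e)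
    {x y u v : H} (hu : u ∈ subdifferential e x) (hv : v ∈ subdifferential e y) :
    0 ≤ ⟪u - v, x - y⟫_ℝ := by
  obtain ⟨r, hr⟩ := he.exists_eq_coe (he.ne_top_of_mem hu)
  obtain ⟨s, hs⟩ := he.exists_eq_coe (he.ne_top_of_mem hv)
  have h1 := hu y
  have h2 := hv x
  rw [hr, hs] at h1 h2
  norm_cast at h1 h2
  rw [← neg_sub x y, inner_neg_right] at h1
  rw [inner_sub_left]
  linarith

/-- A proper lower semicontinuous convex function decreases at most linearly. Near a point `x₀` of
its domain it stays above `e x₀ - 1`, and convexity along the segments issuing from `x₀` carries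
this bound to the whole space. -/
lemma IsProperLscConvex.exists_linear_lower_bound {e : H → EReal} (he : IsProperLscConvex e) :
    ∃ (x₀ : H) (r₀ K : ℝ), 0 ≤ K ∧
      ∀ (y : H) (s : ℝ), e y ≤ s → r₀ - K * ‖y - x₀‖ ≤ s := by
  obtain ⟨x₀, hx₀⟩ := he.exists_ne_top
  obtain ⟨r, hr⟩ := he.exists_eq_coe hx₀
  have hlsc := he.lsc x₀ ((r - 1 : ℝ) : EReal) (by
    change ((r - 1 : ℝ) : EReal) < e x₀
    rw [hr]; norm_cast; linarith)
  obtain ⟨δ, hδ, hball⟩ := Metric.eventually_nhds_iff.1 hlsc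
  refine ⟨x₀, r - 1, 2 / δ, by positivity, fun y s hs => ?_⟩
  by_cases hy : ‖y - x₀‖ < δ
  · have h1 := (hball (by rwa [dist_eq_norm])).trans_le hs
    norm_cast at h1
    have : 0 ≤ 2 / δ * ‖y - x₀‖ := by positivity
    linarith
  · rw [not_lt] at hy
    have hpos : 0 < ‖y - x₀‖ := hδ.trans_le hy
    -- the point of the segment at distance `δ / 2` from `x₀`
    set τ := δ / 2 / ‖y - x₀‖ with hτ
    have hτ0 : 0 < τ := by positivity
    have hτ1 : τ < 1 := by
      rw [hτ, div_lt_one hpos]; linarith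
    have h1 := he.le_coe hr.le hs (sub_pos.2 hτ1) hτ0 (by ring)
    have h2 := hball (y := (1 - τ) • x₀ + τ • y) (by
      have e1 : (1 - τ) • x₀ + τ • y - x₀ = τ • (y - x₀) := by module
      rw [dist_eq_norm, e1, norm_smul, Real.norm_of_nonneg hτ0.le, hτ,
        div_mul_cancel₀ _ hpos.ne']
      linarith)
    have h3 := h2.trans_le h1
    norm_cast at h3
    have h4 : 2 / δ * ‖y - x₀‖ = 1 / τ := by
      rw [hτ]; field_simp
    have h5 : -1 < τ * (s - r) := by linarith
    have h6 : -(1 / τ) < s - r := by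
      rw [← neg_div, div_lt_iff₀ hτ0]; linarith
    linarith

/-- The Moreau proximal problem has a solution. A minimizing sequence is Cauchy by the
parallelogram identity, and lower semicontinuity passes to the limit. -/
lemma IsProperLscConvex.exists_prox [CompleteSpace H] {e : H → EReal} (he : IsProperLscConvex e)
    {k : ℝ} (hk : 0 < k) (x : H) :
    ∃ p, ∀ y, e p + ((k * ‖p - x‖ ^ 2 : ℝ) : EReal) ≤ e y + ((k * ‖y - x‖ ^ 2 : ℝ) : EReal) := by
  set S : Set ℝ := {v | ∃ (y : H) (s : ℝ), e y ≤ s ∧ v = s + k * ‖y - x‖ ^ 2} with hS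
  have hne : S.Nonempty := by
    obtain ⟨y, hy⟩ := he.exists_ne_top
    obtain ⟨s, hs⟩ := he.exists_eq_coe hy
    exact ⟨_, y, s, hs.le, rfl⟩
  have hbdd : BddBelow S := by
    obtain ⟨x₀, r₀, K, hK, hlow⟩ := he.exists_linear_lower_bound
    refine ⟨r₀ - K * ‖x - x₀‖ - K ^ 2 / (4 * k), ?_⟩
    rintro v ⟨y, s, hs, rfl⟩
    have h1 := hlow y s hs
    have h2 : ‖y - x₀‖ ≤ ‖y - x‖ + ‖x - x₀‖ := norm_sub_le_norm_sub_add_norm_sub y x x₀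
    have h3 : K * ‖y - x₀‖ ≤ K * (‖y - x‖ + ‖x - x₀‖) := mul_le_mul_of_nonneg_left h2 hK
    have h4 : k * (‖y - x‖ - K / (2 * k)) ^ 2
        = k * ‖y - x‖ ^ 2 - K * ‖y - x‖ + K ^ 2 / (4 * k) := by
      field_simp; ring
    have h5 : 0 ≤ k * (‖y - x‖ - K / (2 * k)) ^ 2 := by positivity
    linarith
  set m := sInf S with hm
  have hmem : ∀ n : ℕ, ∃ (y : H) (s : ℝ),
      e y ≤ s ∧ s + k * ‖y - x‖ ^ 2 < m + 1 / ((n : ℝ) + 1) := by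
    intro n
    obtain ⟨v, ⟨y, s, hs, rfl⟩, hv⟩ := exists_lt_of_csInf_lt hne
      (show sInf S < m + 1 / ((n : ℝ) + 1) by
        rw [← hm]; linarith [@Nat.one_div_pos_of_nat ℝ _ _ _ n])
    exact ⟨y, s, hs, hv⟩
  choose y s hys hlt using hmem
  have hpar : ∀ i j, k / 4 * ‖y i - y j‖ ^ 2
      ≤ (1 / ((i : ℝ) + 1) + 1 / ((j : ℝ) + 1)) / 2 := by
    intro i j
    have h1 := he.le_coe (hys i) (hys j) (by norm_num : (0 : ℝ) < 1 / 2)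
      (by norm_num : (0 : ℝ) < 1 / 2) (by norm_num)
    have h2 : m ≤ _ := csInf_le hbdd ⟨_, _, h1, rfl⟩
    have h3 := parallelogram_law_with_norm ℝ (y i - x) (y j - x)
    have e1 : y i - x - (y j - x) = y i - y j := by abel
    have e2 : (1 / 2 : ℝ) • y i + (1 / 2 : ℝ) • y j - x
        = (1 / 2 : ℝ) • (y i - x + (y j - x)) := by module
    rw [e1] at h3
    rw [e2, norm_smul, Real.norm_of_nonneg (by norm_num)] at h2
    have h4 : ‖y i - x + (y j - x)‖ ^ 2
        = 2 * ‖y i - x‖ ^ 2 + 2 * ‖y j - x‖ ^ 2 - ‖y i - y j‖ ^ 2 := by linarith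
    rw [mul_pow, h4] at h2
    linarith [hlt i, hlt j]
  have hcauchy : CauchySeq y := by
    rw [Metric.cauchySeq_iff']
    intro ε hε
    obtain ⟨N, hN⟩ := exists_nat_one_div_lt (show 0 < k / 4 * ε ^ 2 by positivity)
    refine ⟨N, fun n hn => ?_⟩
    rw [dist_eq_norm]
    have h1 := hpar n N
    have h2 : 1 / ((n : ℝ) + 1) ≤ 1 / ((N : ℝ) + 1) := Nat.one_div_le_one_div hn
    have h3 : k / 4 * ‖y n - y N‖ ^ 2 < k / 4 * ε ^ 2 := by linarith
    exact lt_of_pow_lt_pow_left₀ 2 hε.le (lt_of_mul_lt_mul_left h3 (by positivity))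
  obtain ⟨p, hp⟩ := cauchySeq_tendsto_of_complete hcauchy
  have hep : e p ≤ ((m - k * ‖p - x‖ ^ 2 : ℝ) : EReal) := by
    by_contra hcon
    rw [not_le] at hcon
    obtain ⟨c, hc1, hc2⟩ := EReal.lt_iff_exists_real_btwn.1 hcon
    norm_cast at hc1
    have h1 : ∀ᶠ n : ℕ in atTop, c ≤ m + 1 / ((n : ℝ) + 1) - k * ‖y n - x‖ ^ 2 := by
      filter_upwards [hp.eventually (he.lsc p c hc2)] with n hn
      have := hn.trans_le (hys n)
      norm_cast at this
      linarith [hlt n]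
    have h2 : Tendsto (fun n : ℕ => m + 1 / ((n : ℝ) + 1) - k * ‖y n - x‖ ^ 2) atTop
        (𝓝 (m + 0 - k * ‖p - x‖ ^ 2)) :=
      (tendsto_const_nhds.add tendsto_one_div_add_atTop_nhds_zero_nat).sub
        (((hp.sub_const x).norm.pow 2).const_mul k)
    have := ge_of_tendsto h2 h1
    linarith
  refine ⟨p, fun z => ?_⟩
  by_cases hz : e z = ⊤
  · rw [hz, EReal.top_add_coe]; exact le_top
  obtain ⟨r, hr⟩ := he.exists_eq_coe hz
  have h1 : m ≤ r + k * ‖z - x‖ ^ 2 := csInf_le hbdd ⟨z, r, hr.le, rfl⟩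
  calc e p + ((k * ‖p - x‖ ^ 2 : ℝ) : EReal)
      ≤ ((m - k * ‖p - x‖ ^ 2 : ℝ) : EReal) + ((k * ‖p - x‖ ^ 2 : ℝ) : EReal) :=
        add_le_add_left hep _
    _ ≤ e z + ((k * ‖z - x‖ ^ 2 : ℝ) : EReal) := by
        rw [hr]; norm_cast; linarith

/-- Fermat's rule for the sum of a convex function and a differentiable one. -/
lemma IsProperLscConvex.neg_mem_subdifferential [CompleteSpace H] {e : H → EReal}
    (he : IsProperLscConvex e) {φ : H → ℝ} {g p : H} (hφ : HasGradientAt φ g p)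
    (hp : ∀ y, e p + (φ p : EReal) ≤ e y + (φ y : EReal)) : -g ∈ subdifferential e p := by
  have hfin : e p ≠ ⊤ := by
    obtain ⟨y, hy⟩ := he.exists_ne_top
    obtain ⟨s, hs⟩ := he.exists_eq_coe hy
    intro h
    have := hp y
    rw [h, EReal.top_add_coe, hs, top_le_iff] at this
    exact EReal.coe_ne_top (s + φ y) (by exact_mod_cast this)
  obtain ⟨r, hr⟩ := he.exists_eq_coe hfin
  intro y
  by_cases hy : e y = ⊤
  · rw [hy]; exact le_top
  obtain ⟨s, hs⟩ := he.exists_eq_coe hy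
  have key := le_inner_gradient_of_line hφ (d := y - p) (C := r - s) (by
    intro t h0 h1
    have h2 := he.le_coe hr.le hs.le (sub_pos.2 h1) h0 (by ring)
    have e1 : (1 - t) • p + t • y = p + t • (y - p) := by module
    rw [e1] at h2
    have h3 := (hp (p + t • (y - p))).trans (add_le_add_left h2 _)
    rw [hr] at h3
    norm_cast at h3
    linarith)
  rw [hr, hs, inner_neg_left]
  norm_cast
  linarith

lemma hasGradientAt_const_mul_norm_sub_sq [CompleteSpace H] (k : ℝ) (x p : H) :
    HasGradientAt (fun y => k * ‖y - x‖ ^ 2) ((2 * k) • (p - x)) p := by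
  rw [hasGradientAt_iff_hasFDerivAt]
  have h := (((hasFDerivAt_id p).sub_const x).norm_sq).const_mul k
  refine h.congr_fderiv ?_
  ext v
  simp
  ring

/-- Minty's theorem for subdifferentials: `I + r ∂e` is onto. -/
lemma IsProperLscConvex.exists_isResolventPoint [CompleteSpace H] {e : H → EReal}
    (he : IsProperLscConvex e) {r : ℝ} (hr : 0 < r) (x : H) :
    ∃ p, IsResolventPoint (subdifferential e) r x p := by
  obtain ⟨p, hp⟩ := he.exists_prox (show 0 < 1 / (2 * r) by positivity) x
  refine ⟨p, _, he.neg_mem_subdifferential (hasGradientAt_const_mul_norm_sub_sq _ x p) hp, ?_⟩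
  have : r * (2 * (1 / (2 * r))) = 1 := by field_simp
  rw [smul_neg, smul_smul, this]
  module

/-- Resolvents of subdifferentials are firmly nonexpansive. -/
lemma IsProperLscConvex.resolvent_firmly_nonexpansive {e : H → EReal} (he : IsProperLscConvex e)
    {r : ℝ} (hr : 0 < r) {x y p q : H} (hp : IsResolventPoint (subdifferential e) r x p)
    (hq : IsResolventPoint (subdifferential e) r y q) :
    ‖p - q‖ ^ 2 ≤ ⟪p - q, x - y⟫_ℝ := by
  obtain ⟨b, hb, rfl⟩ := hp
  obtain ⟨b', hb', rfl⟩ := hq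
  have h := mul_nonneg hr.le (he.subdifferential_monotone hb hb')
  have e1 : p + r • b - (q + r • b') = (p - q) + r • (b - b') := by module
  rw [e1, inner_add_right, real_inner_self_eq_norm_sq, real_inner_smul_right,
    real_inner_comm (b - b')]
  linarith

lemma IsProperLscConvex.isResolventPoint_unique {e : H → EReal} (he : IsProperLscConvex e)
    {r : ℝ} (hr : 0 < r) {x p q : H} (hp : IsResolventPoint (subdifferential e) r x p)
    (hq : IsResolventPoint (subdifferential e) r x q) : p = q := by
  have h := he.resolvent_firmly_nonexpansive hr hp hq
  rw [sub_self, inner_zero_right] at h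
  rw [← sub_eq_zero, ← norm_eq_zero]
  exact pow_eq_zero_iff two_ne_zero |>.1 (le_antisymm h (by positivity))

lemma IsProperLscConvex.existsUnique_isResolventPoint [CompleteSpace H] {e : H → EReal}
    (he : IsProperLscConvex e) {r : ℝ} (hr : 0 < r) (x : H) :
    ∃! p, IsResolventPoint (subdifferential e) r x p := by
  obtain ⟨p, hp⟩ := he.exists_isResolventPoint hr x
  exact ⟨p, hp, fun q hq => he.isResolventPoint_unique hr hq hp⟩

lemma IsProperLscConvex.isResolventPoint_resolventMap [CompleteSpace H] {e : H → EReal}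
    (he : IsProperLscConvex e) {r : ℝ} (hr : 0 < r) (x : H) :
    IsResolventPoint (subdifferential e) r x (resolventMap (subdifferential e) r x) := by
  have h := he.exists_isResolventPoint hr x
  rw [resolventMap, dif_pos h]
  exact h.choose_spec

end Prox

/-! ### Weak limits and the set of minimizers -/

section Weak

variable {H : Type*} [NormedAddCommGroup H] [InnerProductSpace ℝ H]

/-- Bounded families have weak limits along ultrafilters (Banach–Alaoglu and Riesz). -/
lemma exists_weak_limit [CompleteSpace H] {ι : Type*} (U : Ultrafilter ι) {v : ι → H} {M : ℝ}
    (hv : ∀ᶠ i in (U : Filter ι), ‖v i‖ ≤ M) :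
    ∃ w : H, ∀ x, Tendsto (fun i => ⟪v i, x⟫_ℝ) U (𝓝 ⟪w, x⟫_ℝ) := by
  set T : ι → WeakDual ℝ H := fun i => StrongDual.toWeakDual (InnerProductSpace.toDual ℝ H (v i))
  have hK := WeakDual.isCompact_closedBall (𝕜 := ℝ) (E := H) 0 M
  have hT : ((U.map T : Ultrafilter (WeakDual ℝ H)) : Filter (WeakDual ℝ H)) ≤
      𝓟 (WeakDual.toStrongDual ⁻¹' Metric.closedBall 0 M) := by
    rw [le_principal_iff, Ultrafilter.coe_map, mem_map]
    filter_upwards [hv] with i hi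
    simpa [T] using hi
  obtain ⟨f, -, hf⟩ := hK.ultrafilter_le_nhds _ hT
  refine ⟨(InnerProductSpace.toDual ℝ H).symm (WeakDual.toStrongDual f), fun x => ?_⟩
  have h := (WeakDual.eval_continuous (𝕜 := ℝ) x).tendsto f
  have h2 := h.comp (show Tendsto T U (𝓝 f) from hf)
  rw [InnerProductSpace.toDual_symm_apply]
  exact h2

/-- Closed convex sets are weakly closed. -/
lemma mem_of_weak_limit {ι : Type*} {l : Filter ι} [l.NeBot] {C : Set H}
    (hC : Convex ℝ C) (hC' : IsClosed C) {v : ι → H} {w : H}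
    (hv : ∀ x, Tendsto (fun i => ⟪v i, x⟫_ℝ) l (𝓝 ⟪w, x⟫_ℝ)) (hmem : ∀ᶠ i in l, v i ∈ C)
    [CompleteSpace H] : w ∈ C := by
  by_contra hw
  obtain ⟨f, a, ha, hb⟩ := geometric_hahn_banach_closed_point hC hC' hw
  have h1 : Tendsto (fun i => f (v i)) l (𝓝 (f w)) := by
    have := hv ((InnerProductSpace.toDual ℝ H).symm f)
    simpa only [real_inner_comm ((InnerProductSpace.toDual ℝ H).symm f),
      InnerProductSpace.toDual_symm_apply] using this
  have h2 : f w ≤ a := le_of_tendsto h1 (hmem.mono fun i hi => (ha _ hi).le)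
  linarith

/-- The demiclosedness principle for `∂e₁ + ∇e₂`. The approximate inclusions
`s ∈ ∂e₁(t) + ∇e₂(v)`, with `s → 0` and `t - v → 0`, pass to the weak limit of `v` and give a
minimizer of `e₁ + e₂`. -/
lemma isMinimizer_of_weak_limit [CompleteSpace H] {ι : Type*} {l : Filter ι} [l.NeBot]
    {e₁ : H → EReal} (he₁ : IsProperLscConvex e₁) {e₂ : H → ℝ} (he₂ : ConvexOn ℝ Set.univ e₂)
    (he₂' : Differentiable ℝ e₂) {v t s : ι → H} {w : H} {M N : ℝ}
    (hv : ∀ x, Tendsto (fun i => ⟪v i, x⟫_ℝ) l (𝓝 ⟪w, x⟫_ℝ))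
    (hvM : ∀ᶠ i in l, ‖v i‖ ≤ M) (hgN : ∀ᶠ i in l, ‖∇ e₂ (v i)‖ ≤ N)
    (htv : Tendsto (fun i => t i - v i) l (𝓝 0)) (hs : Tendsto s l (𝓝 0))
    (hmem : ∀ᶠ i in l, s i - ∇ e₂ (v i) ∈ subdifferential e₁ (t i)) (y : H) :
    e₁ w + (e₂ w : EReal) ≤ e₁ y + (e₂ y : EReal) := by
  by_cases hy : e₁ y = ⊤
  · rw [hy, EReal.top_add_coe]; exact le_top
  obtain ⟨r, hr⟩ := he₁.exists_eq_coe hy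
  have ht : ∀ x, Tendsto (fun i => ⟪t i, x⟫_ℝ) l (𝓝 ⟪w, x⟫_ℝ) := by
    intro x
    have h := (htv.inner (𝕜 := ℝ) (tendsto_const_nhds (x := x))).add (hv x)
    simpa [inner_sub_left] using h
  have hbd : ∀ {q : ι → H} {Q : ℝ}, (∀ᶠ i in l, ‖q i‖ ≤ Q) → ∀ {p : ι → H}, Tendsto p l (𝓝 0) →
      Tendsto (fun i => ⟪p i, q i⟫_ℝ) l (𝓝 0) := by
    intro q Q hq p hp
    refine squeeze_zero_norm' (a := fun i => ‖p i‖ * Q) ?_ (by simpa using hp.norm.mul_const Q)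
    filter_upwards [hq] with i hi
    exact (norm_inner_le_norm _ _).trans (mul_le_mul_of_nonneg_left hi (norm_nonneg _))
  -- the error in the subgradient inequality tested at `y`
  have herr : Tendsto (fun i => -⟪s i, y - v i⟫_ℝ + ⟪s i, t i - v i⟫_ℝ - ⟪t i - v i, ∇ e₂ (v i)⟫_ℝ
      - ⟪∇ e₂ w, v i - w⟫_ℝ) l (𝓝 0) := by
    have h1 : Tendsto (fun i => ⟪s i, y - v i⟫_ℝ) l (𝓝 0) := by
      refine hbd (Q := ‖y‖ + M) ?_ hs
      filter_upwards [hvM] with i hi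
      exact (norm_sub_le _ _).trans (by linarith)
    have h2 : Tendsto (fun i => ⟪s i, t i - v i⟫_ℝ) l (𝓝 0) := by
      simpa using hs.inner (𝕜 := ℝ) htv
    have h3 := hbd hgN htv
    have h4 : Tendsto (fun i => ⟪∇ e₂ w, v i - w⟫_ℝ) l (𝓝 0) := by
      have := (hv (∇ e₂ w)).sub_const ⟪w, ∇ e₂ w⟫_ℝ
      simpa only [inner_sub_right, real_inner_comm, sub_self] using this
    simpa using ((h1.neg.add h2).sub h3).sub h4
  have hle : ∀ ε : ℝ, 0 < ε → e₁ w ≤ ((r + e₂ y - e₂ w + ε : ℝ) : EReal) := by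
    intro ε hε
    refine mem_of_weak_limit (he₁.convex_sublevel _) (he₁.lsc.isClosed_preimage _) ht ?_
    filter_upwards [hmem, herr.eventually_lt_const hε] with i hi hεi
    obtain ⟨q, hq⟩ := he₁.exists_eq_coe (he₁.ne_top_of_mem hi)
    have h1 := hi y
    rw [hq, hr] at h1
    change e₁ (t i) ≤ _
    rw [hq]
    norm_cast at h1 ⊢
    have h2 := add_inner_gradient_le he₂ he₂' (v i) y
    have h3 := add_inner_gradient_le he₂ he₂' w (v i)
    have e1 : ⟪s i - ∇ e₂ (v i), y - t i⟫_ℝ = ⟪s i, y - v i⟫_ℝ - ⟪s i, t i - v i⟫_ℝ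
        + ⟪t i - v i, ∇ e₂ (v i)⟫_ℝ - ⟪∇ e₂ (v i), y - v i⟫_ℝ := by
      rw [real_inner_comm (∇ e₂ (v i)) (t i - v i)]
      simp only [inner_sub_left, inner_sub_right]
      ring
    linarith
  have hfin : e₁ w ≠ ⊤ := fun h => by
    have := hle 1 one_pos
    rw [h, top_le_iff] at this
    exact EReal.coe_ne_top _ this
  obtain ⟨q, hq⟩ := he₁.exists_eq_coe hfin
  rw [hq, hr]
  simp only [hq] at hle
  norm_cast at hle ⊢
  have := le_of_forall_pos_le_add hle
  linarith

/-- Closedness is the demiclosedness principle applied to strongly convergent minimizers. -/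
lemma isClosed_minimizers [CompleteSpace H]
    {e₁ : H → EReal} (he₁ : IsProperLscConvex e₁) {e₂ : H → ℝ} (he₂ : ConvexOn ℝ Set.univ e₂)
    (he₂' : Differentiable ℝ e₂) (hc : Continuous (∇ e₂)) :
    IsClosed {x | ∀ y, e₁ x + (e₂ x : EReal) ≤ e₁ y + (e₂ y : EReal)} := by
  refine isClosed_of_closure_subset fun w hw => ?_
  rw [mem_closure_iff_nhdsWithin_neBot] at hw
  set S := {x | ∀ y, e₁ x + (e₂ x : EReal) ≤ e₁ y + (e₂ y : EReal)} with hS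
  have hid : Tendsto (fun x : H => x) (𝓝[S] w) (𝓝 w) := nhdsWithin_le_nhds
  have hg : Tendsto (fun x : H => ∇ e₂ x) (𝓝[S] w) (𝓝 (∇ e₂ w)) := (hc.tendsto w).comp hid
  refine isMinimizer_of_weak_limit (l := 𝓝[S] w) he₁ he₂ he₂' (v := fun x => x) (t := fun x => x)
    (s := fun _ => 0) (M := ‖w‖ + 1) (N := ‖∇ e₂ w‖ + 1)
    (fun x => hid.inner tendsto_const_nhds)
    (hid.norm.eventually_le_const (lt_add_one _)) (hg.norm.eventually_le_const (lt_add_one _))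
    (by simp) tendsto_const_nhds ?_
  filter_upwards [self_mem_nhdsWithin] with x hx
  rw [zero_sub]
  exact he₁.neg_mem_subdifferential (he₂' x).hasGradientAt hx

lemma convex_minimizers
    {e₁ : H → EReal} (he₁ : IsProperLscConvex e₁) {e₂ : H → ℝ} (he₂ : ConvexOn ℝ Set.univ e₂) :
    Convex ℝ {x | ∀ y, e₁ x + (e₂ x : EReal) ≤ e₁ y + (e₂ y : EReal)} := by
  rw [convex_iff_forall_pos]
  intro x hx y hy a b ha hb hab z
  by_cases hz : e₁ z = ⊤
  · rw [hz, EReal.top_add_coe]; exact le_top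
  obtain ⟨r, hr⟩ := he₁.exists_eq_coe hz
  have key : ∀ u, (∀ y, e₁ u + (e₂ u : EReal) ≤ e₁ y + (e₂ y : EReal)) →
      e₁ u ≤ ((r + e₂ z - e₂ u : ℝ) : EReal) := by
    intro u hu
    have h := hu z
    have hfin : e₁ u ≠ ⊤ := by
      intro h'
      rw [h', EReal.top_add_coe, hr, top_le_iff] at h
      exact EReal.coe_ne_top (r + e₂ z) (by exact_mod_cast h)
    obtain ⟨q, hq⟩ := he₁.exists_eq_coe hfin
    rw [hq, hr] at h
    rw [hq]
    norm_cast at h ⊢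
    linarith
  have h1 := he₁.le_coe (key x hx) (key y hy) ha hb hab
  have h2 := he₂.2 (Set.mem_univ x) (Set.mem_univ y) ha.le hb.le hab
  simp only [smul_eq_mul] at h2
  refine (add_le_add_left h1 _).trans ?_
  rw [hr]
  norm_cast
  have : a * (r + e₂ z) + b * (r + e₂ z) = r + e₂ z := by rw [← add_mul, hab, one_mul]
  linarith

end Weak

/-! ### Strongly monotone variational inequalities -/

section Variational

variable {H : Type*} [NormedAddCommGroup H] [InnerProductSpace ℝ H]

lemma variationalInequality_unique {C : Set H} {F : H → H} {γ : ℝ} (hF : IsStronglyMonotone F γ)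
    {u v : H} (hu : u ∈ C) (hv : v ∈ C) (hu' : ∀ x ∈ C, 0 ≤ ⟪F u, x - u⟫_ℝ)
    (hv' : ∀ x ∈ C, 0 ≤ ⟪F v, x - v⟫_ℝ) : v = u := by
  have h1 := hu' v hv
  have h2 := hv' u hu
  have h3 := hF.2 v u
  rw [← neg_sub v u, inner_neg_right] at h2
  rw [inner_sub_left] at h3
  have h4 : ‖v - u‖ ^ 2 ≤ 0 := by
    by_contra hcon
    have := mul_pos hF.1 (not_le.1 hcon)
    linarith
  rw [← sub_eq_zero, ← norm_eq_zero]
  exact pow_eq_zero_iff two_ne_zero |>.1 (le_antisymm h4 (by positivity))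

/-- A strongly monotone Lipschitz variational inequality over a nonempty closed convex set has a
solution, namely the fixed point of the contraction `x ↦ P (x - μ F x)`, where `P` is the metric
projection and `μ = γ / (γ² + L²)`. -/
lemma exists_variationalInequality [CompleteSpace H] {C : Set H} (hne : C.Nonempty)
    (hC : IsClosed C) (hconv : Convex ℝ C) {F : H → H} {γ : ℝ} (hF : IsStronglyMonotone F γ)
    {L : ℝ≥0} (hL : LipschitzWith L F) : ∃ u ∈ C, ∀ x ∈ C, 0 ≤ ⟪F u, x - u⟫_ℝ := by
  have hproj : ∀ x : H, ∃ p ∈ C, ∀ y ∈ C, ⟪x - p, y - p⟫_ℝ ≤ 0 := by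
    intro x
    obtain ⟨p, hp, hp'⟩ := exists_norm_eq_iInf_of_complete_convex hne hC.isComplete hconv x
    exact ⟨p, hp, (norm_eq_iInf_iff_real_inner_le_zero hconv hp).1 hp'⟩
  choose P hPC hP using hproj
  have hPlip : ∀ x y, ‖P x - P y‖ ≤ ‖x - y‖ := by
    intro x y
    have h1 := hP x (P y) (hPC y)
    have h2 := hP y (P x) (hPC x)
    rw [← neg_sub (P x) (P y), inner_neg_right] at h1
    have h3 : ‖P x - P y‖ ^ 2 ≤ ⟪x - y, P x - P y⟫_ℝ := by
      have e1 : ⟪x - y, P x - P y⟫_ℝ = ⟪x - P x, P x - P y⟫_ℝ - ⟪y - P y, P x - P y⟫_ℝ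
          + ⟪P x - P y, P x - P y⟫_ℝ := by
        rw [← inner_sub_left, ← inner_add_left]
        congr 1
        abel
      rw [e1, real_inner_self_eq_norm_sq]
      linarith
    have h4 := real_inner_le_norm (x - y) (P x - P y)
    by_contra hcon
    rw [not_le] at hcon
    nlinarith [norm_nonneg (x - y)]
  have hγ := hF.1
  set μ := γ / (γ ^ 2 + (L : ℝ) ^ 2) with hμ
  have hμ0 : 0 < μ := by positivity
  have hμL : μ * (γ ^ 2 + (L : ℝ) ^ 2) = γ := by rw [hμ]; field_simp
  have hμγ : 0 ≤ 1 - μ * γ := by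
    have h1 : μ * γ = γ ^ 2 / (γ ^ 2 + (L : ℝ) ^ 2) := by rw [hμ]; ring
    rw [h1, sub_nonneg, div_le_one (by positivity)]
    linarith [sq_nonneg (L : ℝ)]
  have hμL2 : μ ^ 2 * (L : ℝ) ^ 2 ≤ μ * γ := by
    nlinarith [mul_nonneg hμ0.le (mul_nonneg hμ0.le (sq_nonneg γ))]
  have hcontr : ContractingWith (Real.toNNReal √(1 - μ * γ)) (fun x => P (x - μ • F x)) := by
    refine ⟨?_, LipschitzWith.of_dist_le_mul fun x y => ?_⟩
    · rw [← Real.toNNReal_one, Real.toNNReal_lt_toNNReal_iff one_pos, Real.sqrt_lt' one_pos]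
      linarith [mul_pos hμ0 hγ]
    · rw [dist_eq_norm, dist_eq_norm, Real.coe_toNNReal _ (Real.sqrt_nonneg _)]
      refine (hPlip _ _).trans (abs_le_of_sq_le_sq' ?_ (by positivity)).2
      have e1 : x - μ • F x - (y - μ • F y) = (x - y) - μ • (F x - F y) := by module
      rw [e1, mul_pow, Real.sq_sqrt hμγ, norm_sub_sq_real, real_inner_smul_right, norm_smul,
        Real.norm_of_nonneg hμ0.le, real_inner_comm, mul_pow]
      have h1 := mul_le_mul_of_nonneg_left (hF.2 x y) hμ0.le
      have h2 := mul_le_mul_of_nonneg_left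
        (pow_le_pow_left₀ (norm_nonneg _) (hL.norm_sub_le x y) 2) (sq_nonneg μ)
      have h3 := mul_le_mul_of_nonneg_right hμL2 (sq_nonneg ‖x - y‖)
      rw [mul_pow] at h2
      linarith
  obtain ⟨u, hu, -⟩ := hcontr.exists_fixedPoint hne.some (edist_ne_top _ _)
  have hu' : P (u - μ • F u) = u := hu
  refine ⟨u, hu' ▸ hPC _, fun x hx => ?_⟩
  have h := hP (u - μ • F u) x hx
  rw [hu', sub_sub_cancel_left, inner_neg_left, real_inner_smul_left, neg_nonpos] at h
  exact nonneg_of_mul_nonneg_right h hμ0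

end Variational

/-! ### A recursive inequality -/

section Sequence

/-- A sequence dominated by `s (n + 1) ≤ (1 - t n) s n + o(t n)`, with `∑ t n = ∞`, tends to
zero. -/
lemma tendsto_zero_of_recursive_le {s t : ℕ → ℝ} (hs : ∀ n, 0 ≤ s n)
    (ht1 : ∀ᶠ n in atTop, t n ≤ 1)
    (hsum : Tendsto (fun N => ∑ n ∈ Finset.range N, t n) atTop atTop)
    (hrec : ∀ ε > 0, ∀ᶠ n in atTop, s (n + 1) ≤ (1 - t n) * s n + t n * ε) :
    Tendsto s atTop (𝓝 0) := by
  rw [Metric.tendsto_atTop']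
  intro ε hε
  obtain ⟨N, hN⟩ := eventually_atTop.1 (ht1.and (hrec (ε / 2) (half_pos hε)))
  have key : ∀ n, N ≤ n → s n - ε / 2 ≤ max (s N - ε / 2) 0 *
      Real.exp (∑ i ∈ Finset.range N, t i - ∑ i ∈ Finset.range n, t i) := by
    intro n hn
    induction n, hn using Nat.le_induction with
    | base => simp
    | succ n hn ih =>
      obtain ⟨h1, h2⟩ := hN n hn
      have h3 : s (n + 1) - ε / 2 ≤ (1 - t n) * (s n - ε / 2) := by linarith
      refine h3.trans ((mul_le_mul_of_nonneg_left ih (sub_nonneg.2 h1)).trans ?_)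
      rw [Finset.sum_range_succ, ← sub_sub, sub_eq_add_neg _ (t n), sub_eq_add_neg _ (t n),
        Real.exp_add, ← sub_eq_add_neg 1 (t n)]
      have h4 : 1 - t n ≤ Real.exp (-t n) := Real.one_sub_le_exp_neg _
      have h5 : 0 ≤ max (s N - ε / 2) 0 *
          Real.exp (∑ i ∈ Finset.range N, t i - ∑ i ∈ Finset.range n, t i) := by positivity
      nlinarith [mul_le_mul_of_nonneg_right h4 h5]
  have hlim : Tendsto (fun n => max (s N - ε / 2) 0 *
      Real.exp (∑ i ∈ Finset.range N, t i - ∑ i ∈ Finset.range n, t i)) atTop (𝓝 0) := by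
    have h1 : Tendsto (fun n => ∑ i ∈ Finset.range N, t i - ∑ i ∈ Finset.range n, t i)
        atTop atBot := by
      simp only [sub_eq_add_neg]
      exact tendsto_atBot_add_const_left _ _ (tendsto_neg_atTop_atBot.comp hsum)
    simpa using (Real.tendsto_exp_atBot.comp h1).const_mul (max (s N - ε / 2) 0)
  obtain ⟨K, hK⟩ := eventually_atTop.1 (hlim.eventually_lt_const (half_pos hε))
  refine ⟨max N K, fun n hn => ?_⟩
  have h1 := key n ((le_max_left _ _).trans hn.le)
  have h2 := hK n ((le_max_right _ _).trans hn.le)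
  rw [Real.dist_eq, sub_zero, abs_of_nonneg (hs n)]
  linarith

end Sequence

/-! ### Estimates for one iteration -/

section OneStep

variable {H₁ H₂ : Type*}
  [NormedAddCommGroup H₁] [InnerProductSpace ℝ H₁] [CompleteSpace H₁]
  [NormedAddCommGroup H₂] [InnerProductSpace ℝ H₂] [CompleteSpace H₂]

/-- The displacement `(I - T) (A z)` of `A z` under the forward-backward map
`T = (I + r ∂g₁)⁻¹ (I - r ∇g₂)`. -/
noncomputable def residual (A : H₁ →L[ℝ] H₂) (g₁ : H₂ → EReal) (g₂ : H₂ → ℝ) (r : ℝ) (z : H₁) :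
    H₂ :=
  A z - resolventMap (subdifferential g₁) r (A z - r • ∇ g₂ (A z))

/-- The explicit part of one iteration: the point to which the resolvent of `∂e₁` is applied. -/
noncomputable def forwardPoint (A : H₁ →L[ℝ] H₂) (e₂ : H₁ → ℝ) (g₁ : H₂ → EReal) (g₂ : H₂ → ℝ)
    (F : H₁ → H₁) (r a : ℝ) (z : H₁) : H₁ :=
  z - r • ∇ e₂ z - r • ContinuousLinearMap.adjoint A (residual A g₁ g₂ r z) - (r * a) • F z

/-- The deviation of the explicit part at `z` from the unregularized explicit part at a
solution `u`, where the residual vanishes. -/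
noncomputable def forwardDiff (A : H₁ →L[ℝ] H₂) (e₂ : H₁ → ℝ) (g₁ : H₂ → EReal) (g₂ : H₂ → ℝ)
    (F : H₁ → H₁) (r a : ℝ) (z u : H₁) : H₁ :=
  forwardPoint A e₂ g₁ g₂ F r a z - (u - r • ∇ e₂ u)

/-- Coercivity of `I - T` at a minimizer `q`, for the forward-backward map
`T = (I + r ∂g₁)⁻¹ (I - r ∇g₂)` with a step size `r ≤ 1 / (2 L)`. -/
lemma norm_sq_le_inner_of_isMinimizer {H : Type*} [NormedAddCommGroup H] [InnerProductSpace ℝ H]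
    [CompleteSpace H] {g₁ : H → EReal} (hg₁ : IsProperLscConvex g₁)
    {g₂ : H → ℝ} (hg₂ : ConvexOn ℝ Set.univ g₂) (hg₂' : Differentiable ℝ g₂)
    {L : ℝ≥0} (hL : 0 < L) (hLip : LipschitzWith L (∇ g₂)) {r : ℝ} (hr : 0 < r)
    (hrL : r * L ≤ 1 / 2) {q : H} (hq : ∀ y, g₁ q + (g₂ q : EReal) ≤ g₁ y + (g₂ y : EReal))
    {v t : H} (ht : IsResolventPoint (subdifferential g₁) r (v - r • ∇ g₂ v) t) :
    7 / 8 * ‖v - t‖ ^ 2 ≤ ⟪v - t, v - q⟫_ℝ := by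
  have hL' : (0 : ℝ) < L := hL
  have hq' : IsResolventPoint (subdifferential g₁) r (q - r • ∇ g₂ q) q :=
    ⟨_, hg₁.neg_mem_subdifferential (hg₂' q).hasGradientAt hq, by module⟩
  have h1 := hg₁.resolvent_firmly_nonexpansive hr ht hq'
  have h2 := mul_le_mul_of_nonneg_left (gradient_cocoercive hg₂ hg₂' hL hLip v q) hr.le
  set h := ∇ g₂ v - ∇ g₂ q with hh
  have e1 : v - r • ∇ g₂ v - (q - r • ∇ g₂ q) = (v - t) + (t - q) - r • h := by
    rw [hh]; module
  have e2 : v - q = (v - t) + (t - q) := by abel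
  rw [e1, inner_sub_right, inner_add_right, real_inner_self_eq_norm_sq, real_inner_smul_right] at h1
  rw [e2, inner_add_right] at h2
  rw [e2, inner_add_right, real_inner_self_eq_norm_sq, real_inner_comm (t - q) (v - t)]
  rw [real_inner_comm h (t - q)] at h1
  have h3 := mul_le_mul_of_nonneg_left (real_inner_le_norm h (v - t)) hr.le
  -- completing the square in `‖h‖`, with `r * L / 4 ≤ 1 / 8`
  have h4 : 0 ≤ r * (1 / L) * (‖h‖ - L / 2 * ‖v - t‖) ^ 2 := by positivity
  have h5 : r * (1 / L) * (‖h‖ - L / 2 * ‖v - t‖) ^ 2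
      = r * (1 / L * ‖h‖ ^ 2) - r * (‖h‖ * ‖v - t‖) + r * L / 4 * ‖v - t‖ ^ 2 := by
    field_simp; ring
  have h6 : r * L / 4 * ‖v - t‖ ^ 2 ≤ 1 / 8 * ‖v - t‖ ^ 2 :=
    mul_le_mul_of_nonneg_right (by linarith) (sq_nonneg _)
  linarith

/-- The regularized explicit step contracts by the factor `1 - r a γ` and gains multiples of the
squared norms of the two residual terms `p` and `b`. -/
lemma norm_sq_forward_le (A : H₁ →L[ℝ] H₂) {d p k : H₁} {b : H₂} {r a γ L₁ L : ℝ}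
    (hr : 0 < r) (hL₁ : 0 < L₁) (hrL : r * L₁ ≤ 1 / 2) (hrA : r * ‖A‖ ^ 2 ≤ 1 / 2)
    (hp : 1 / L₁ * ‖p‖ ^ 2 ≤ ⟪p, d⟫_ℝ) (hb : 7 / 8 * ‖b‖ ^ 2 ≤ ⟪b, A d⟫_ℝ)
    (hk : γ * ‖d‖ ^ 2 ≤ ⟪k, d⟫_ℝ) (hkL : ‖k‖ ≤ L * ‖d‖) (ha : 0 ≤ a)
    (hsmall : 3 * (r * a) * L ^ 2 ≤ γ) :
    ‖d - r • (p + ContinuousLinearMap.adjoint A b) - (r * a) • k‖ ^ 2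
      ≤ (1 - r * a * γ) * ‖d‖ ^ 2 - r / (2 * L₁) * ‖p‖ ^ 2 - r / 4 * ‖b‖ ^ 2 := by
  set q := ContinuousLinearMap.adjoint A b with hq
  have hqd : ⟪q, d⟫_ℝ = ⟪b, A d⟫_ℝ := ContinuousLinearMap.adjoint_inner_left A d b
  have hqn : ‖q‖ ^ 2 ≤ ‖A‖ ^ 2 * ‖b‖ ^ 2 := by
    rw [← mul_pow]
    refine pow_le_pow_left₀ (norm_nonneg _) ?_ 2
    have := (ContinuousLinearMap.adjoint A).le_opNorm b
    rwa [LinearIsometryEquiv.norm_map] at this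
  have hB : r ^ 2 * ‖p + q‖ ^ 2 ≤ r / L₁ * ‖p‖ ^ 2 + r * ‖b‖ ^ 2 := by
    have h1 : ‖p + q‖ ^ 2 ≤ 2 * ‖p‖ ^ 2 + 2 * ‖q‖ ^ 2 := by
      have := parallelogram_law_with_norm ℝ p q
      nlinarith [sq_nonneg ‖p - q‖]
    have h2 : r ^ 2 * (2 * ‖p‖ ^ 2) ≤ r / L₁ * ‖p‖ ^ 2 := by
      have : r * (r * L₁) * (2 / L₁ * ‖p‖ ^ 2) ≤ r * (1 / 2) * (2 / L₁ * ‖p‖ ^ 2) := by gcongr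
      calc r ^ 2 * (2 * ‖p‖ ^ 2) = r * (r * L₁) * (2 / L₁ * ‖p‖ ^ 2) := by field_simp
        _ ≤ _ := this
        _ = _ := by ring
    have h3 : r ^ 2 * (2 * ‖q‖ ^ 2) ≤ r * ‖b‖ ^ 2 := by
      calc r ^ 2 * (2 * ‖q‖ ^ 2) ≤ r ^ 2 * (2 * (‖A‖ ^ 2 * ‖b‖ ^ 2)) := by gcongr
        _ = r * (r * ‖A‖ ^ 2) * (2 * ‖b‖ ^ 2) := by ring
        _ ≤ r * (1 / 2) * (2 * ‖b‖ ^ 2) := by gcongr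
        _ = _ := by ring
    have h4 := mul_le_mul_of_nonneg_left h1 (sq_nonneg r)
    linarith
  have hk2 : ‖k‖ ^ 2 ≤ L ^ 2 * ‖d‖ ^ 2 := by
    rw [← mul_pow]
    exact pow_le_pow_left₀ (norm_nonneg _) hkL 2
  have hexp : ‖d - r • (p + q) - (r * a) • k‖ ^ 2 = ‖d‖ ^ 2 - 2 * r * (⟪p, d⟫_ℝ + ⟪q, d⟫_ℝ)
      + r ^ 2 * ‖p + q‖ ^ 2 - 2 * (r * a) * ⟪k, d⟫_ℝ + 2 * (r * a) * r * ⟪k, p + q⟫_ℝ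
      + (r * a) ^ 2 * ‖k‖ ^ 2 := by
    rw [norm_sub_sq_real, norm_sub_sq_real, norm_smul, norm_smul, mul_pow, mul_pow,
      Real.norm_eq_abs, Real.norm_eq_abs, sq_abs, sq_abs, real_inner_smul_right,
      real_inner_smul_right, inner_sub_left, real_inner_smul_left, real_inner_comm (p + q) d,
      real_inner_comm k d, real_inner_comm k (p + q), inner_add_left]
    ring
  have hcross : 2 * (r * a) * r * ⟪k, p + q⟫_ℝ
      ≤ 1 / 2 * (r ^ 2 * ‖p + q‖ ^ 2) + 2 * (r * a) ^ 2 * ‖k‖ ^ 2 := by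
    have h1 := mul_le_mul_of_nonneg_left (real_inner_le_norm k (p + q))
      (show 0 ≤ 2 * (r * a) * r by positivity)
    nlinarith [sq_nonneg (r * ‖p + q‖ - 2 * (r * a) * ‖k‖)]
  have h1 := mul_le_mul_of_nonneg_left hp (show 0 ≤ 2 * r by positivity)
  have h2 := mul_le_mul_of_nonneg_left hb (show 0 ≤ 2 * r by positivity)
  have h3 := mul_le_mul_of_nonneg_left hk (show 0 ≤ 2 * (r * a) by positivity)
  have h4 := mul_le_mul_of_nonneg_left hk2 (show 0 ≤ 3 * (r * a) ^ 2 by positivity)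
  have h5 := mul_le_mul_of_nonneg_right (mul_le_mul_of_nonneg_left hsmall
    (show 0 ≤ r * a by positivity)) (sq_nonneg ‖d‖)
  have h6 : 2 * r * (1 / L₁ * ‖p‖ ^ 2) - 3 / 2 * (r / L₁ * ‖p‖ ^ 2) = r / (2 * L₁) * ‖p‖ ^ 2 := by
    field_simp; ring
  rw [hexp, hqd]
  linarith

variable {A : H₁ →L[ℝ] H₂} {e₁ : H₁ → EReal} {g₁ : H₂ → EReal} {e₂ : H₁ → ℝ} {g₂ : H₂ → ℝ}
  {F : H₁ → H₁}

/-- The forward step at an iterate, with the perturbation `F u` removed, contracts squared distances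
to a solution `u`. -/
lemma forwardDiff_norm_sq_le (hg₁ : IsProperLscConvex g₁)
    (he₂ : ConvexOn ℝ Set.univ e₂) (he₂' : Differentiable ℝ e₂)
    (hg₂ : ConvexOn ℝ Set.univ g₂) (hg₂' : Differentiable ℝ g₂)
    {L₁ L₂ L : ℝ≥0} (hL₁ : 0 < L₁) (hL₂ : 0 < L₂)
    (he₂L : LipschitzWith L₁ (∇ e₂)) (hg₂L : LipschitzWith L₂ (∇ g₂))
    {γ : ℝ} (hF : IsStronglyMonotone F γ) (hFL : LipschitzWith L F)
    {r a : ℝ} (hr : 0 < r) (ha : 0 ≤ a) (hrL₁ : r * L₁ ≤ 1 / 2) (hrL₂ : r * L₂ ≤ 1 / 2)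
    (hrA : r * ‖A‖ ^ 2 ≤ 1 / 2) (hsmall : 3 * (r * a) * (L : ℝ) ^ 2 ≤ γ) {u : H₁}
    (hu : u ∈ solutionSet A e₁ e₂ g₁ g₂) (z : H₁) :
    ‖forwardDiff A e₂ g₁ g₂ F r a z u + (r * a) • F u‖ ^ 2
      ≤ (1 - r * a * γ) * ‖z - u‖ ^ 2 - r / (2 * L₁) * ‖∇ e₂ z - ∇ e₂ u‖ ^ 2
        - r / 4 * ‖residual A g₁ g₂ r z‖ ^ 2 := by
  have hb : 7 / 8 * ‖residual A g₁ g₂ r z‖ ^ 2 ≤ ⟪residual A g₁ g₂ r z, A (z - u)⟫_ℝ := by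
    rw [map_sub]
    exact norm_sq_le_inner_of_isMinimizer hg₁ hg₂ hg₂' hL₂ hg₂L hr hrL₂ hu.2
      (hg₁.isResolventPoint_resolventMap hr _)
  have h := norm_sq_forward_le A hr hL₁ hrL₁ hrA (gradient_cocoercive he₂ he₂' hL₁ he₂L z u) hb
    (hF.2 z u) (hFL.norm_sub_le z u) ha hsmall
  have e : forwardDiff A e₂ g₁ g₂ F r a z u + (r * a) • F u
      = z - u - r • (∇ e₂ z - ∇ e₂ u + ContinuousLinearMap.adjoint A (residual A g₁ g₂ r z))
        - (r * a) • (F z - F u) := by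
    rw [forwardDiff, forwardPoint]; module
  rw [e]
  exact h

/-- Firm nonexpansiveness of the backward step, applied at an iterate and at a solution. -/
lemma step_sub_norm_sq_le (he₁ : IsProperLscConvex e₁) (he₂' : Differentiable ℝ e₂)
    {r a : ℝ} (hr : 0 < r) {u : H₁} (hu : u ∈ solutionSet A e₁ e₂ g₁ g₂) (z : H₁) :
    ‖step A e₁ e₂ g₁ g₂ F r a z - u‖ ^ 2 +
      ‖forwardDiff A e₂ g₁ g₂ F r a z u - (step A e₁ e₂ g₁ g₂ F r a z - u)‖ ^ 2
      ≤ ‖forwardDiff A e₂ g₁ g₂ F r a z u‖ ^ 2 := by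
  have hu' : IsResolventPoint (subdifferential e₁) r (u - r • ∇ e₂ u) u :=
    ⟨_, he₁.neg_mem_subdifferential (he₂' u).hasGradientAt hu.1, by module⟩
  have hz : IsResolventPoint (subdifferential e₁) r (forwardPoint A e₂ g₁ g₂ F r a z)
      (step A e₁ e₂ g₁ g₂ F r a z) := he₁.isResolventPoint_resolventMap hr _
  have h := he₁.resolvent_firmly_nonexpansive hr hz hu'
  rw [← forwardDiff] at h
  rw [norm_sub_sq_real (forwardDiff A e₂ g₁ g₂ F r a z u), real_inner_comm]
  linarith

end OneStep

/-! ### Weak limits of the iteration -/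

section Limit

variable {H₁ H₂ : Type*}
  [NormedAddCommGroup H₁] [InnerProductSpace ℝ H₁] [CompleteSpace H₁]
  [NormedAddCommGroup H₂] [InnerProductSpace ℝ H₂] [CompleteSpace H₂]
  {A : H₁ →L[ℝ] H₂} {e₁ : H₁ → EReal} {g₁ : H₂ → EReal} {e₂ : H₁ → ℝ} {g₂ : H₂ → ℝ}
  {F : H₁ → H₁}

lemma tendsto_zero_of_mul_norm_sq_le {ι H : Type*} [NormedAddCommGroup H] {l : Filter ι}
    {x : ι → H} {E : ι → ℝ} {K : ℝ} (hK : 0 < K) (hE : Tendsto E l (𝓝 0))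
    (h : ∀ᶠ i in l, K * ‖x i‖ ^ 2 ≤ E i) : Tendsto x l (𝓝 0) := by
  rw [tendsto_zero_iff_norm_tendsto_zero]
  have h1 : Tendsto (fun i => ‖x i‖ ^ 2) l (𝓝 0) := by
    refine squeeze_zero' (Eventually.of_forall fun i => sq_nonneg _) (g := fun i => K⁻¹ * E i) ?_
      (by simpa using hE.const_mul K⁻¹)
    filter_upwards [h] with i hi
    rwa [le_inv_mul_iff₀ hK]
  have h2 := h1.sqrt
  simpa using h2

lemma tendsto_smul_zero_of_bounded {ι H : Type*} [NormedAddCommGroup H] [NormedSpace ℝ H]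
    {l : Filter ι} {x : ι → H} {k : ι → ℝ} {K : ℝ} (hk : ∀ᶠ i in l, |k i| ≤ K)
    (hx : Tendsto x l (𝓝 0)) : Tendsto (fun i => k i • x i) l (𝓝 0) := by
  refine squeeze_zero_norm' (a := fun i => K * ‖x i‖) ?_ (by simpa using hx.norm.const_mul K)
  filter_upwards [hk] with i hi
  rw [norm_smul, Real.norm_eq_abs]
  exact mul_le_mul_of_nonneg_right hi (norm_nonneg _)

lemma norm_le_of_lipschitzWith {E G : Type*} [NormedAddCommGroup E]
    [NormedAddCommGroup G] {f : E → G} {K : ℝ≥0} (hf : LipschitzWith K f) {x u : E} {M : ℝ}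
    (h : ‖x - u‖ ≤ M) : ‖f x‖ ≤ ‖f u‖ + K * M := by
  have h1 := (hf.norm_sub_le x u).trans (mul_le_mul_of_nonneg_left h K.2)
  have h2 := norm_le_norm_add_norm_sub' (f x) (f u)
  linarith

/-- Along an ultrafilter on which the residual terms of the iteration vanish, the deviations
`forwardDiff` converge weakly to `w - u` for some solution `w`. The varying step sizes only need
to stay between two positive constants. -/
lemma exists_mem_solutionSet_tendsto_inner (he₁ : IsProperLscConvex e₁)
    (hg₁ : IsProperLscConvex g₁)
    (he₂ : ConvexOn ℝ Set.univ e₂) (he₂' : Differentiable ℝ e₂)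
    (hg₂ : ConvexOn ℝ Set.univ g₂) (hg₂' : Differentiable ℝ g₂)
    {L₁ L₂ L : ℝ≥0} (he₂L : LipschitzWith L₁ (∇ e₂)) (hg₂L : LipschitzWith L₂ (∇ g₂))
    (hFL : LipschitzWith L F) {ι : Type*} (U : Ultrafilter ι) {z : ι → H₁} {r a : ι → ℝ} {u : H₁}
    {c R M : ℝ} (hc : 0 < c) (hcr : ∀ i, c ≤ r i) (hrR : ∀ i, r i ≤ R)
    (ha : Tendsto a U (𝓝 0)) (hM : ∀ᶠ i in (U : Filter ι), ‖z i - u‖ ≤ M)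
    (hp : Tendsto (fun i => ∇ e₂ (z i) - ∇ e₂ u) U (𝓝 0))
    (hb : Tendsto (fun i => residual A g₁ g₂ (r i) (z i)) U (𝓝 0))
    (hd : Tendsto (fun i => forwardDiff A e₂ g₁ g₂ F (r i) (a i) (z i) u
      - (step A e₁ e₂ g₁ g₂ F (r i) (a i) (z i) - u)) U (𝓝 0)) (x : H₁) :
    ∃ w ∈ solutionSet A e₁ e₂ g₁ g₂,
      Tendsto (fun i => ⟪x, forwardDiff A e₂ g₁ g₂ F (r i) (a i) (z i) u⟫_ℝ) U
        (𝓝 ⟪x, w - u⟫_ℝ) := by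
  have hr0 : ∀ i, 0 < r i := fun i => hc.trans_le (hcr i)
  have hzM : ∀ᶠ i in (U : Filter ι), ‖z i‖ ≤ ‖u‖ + M := by
    filter_upwards [hM] with i hi
    linarith [norm_le_norm_add_norm_sub' (z i) u]
  have hAM : ∀ᶠ i in (U : Filter ι), ‖A (z i) - A u‖ ≤ ‖A‖ * M := by
    filter_upwards [hM] with i hi
    rw [← map_sub]
    exact (A.le_opNorm _).trans (mul_le_mul_of_nonneg_left hi (norm_nonneg _))
  obtain ⟨w, hw⟩ := exists_weak_limit U hzM
  have hrb : ∀ᶠ i in (U : Filter ι), |r i| ≤ R :=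
    Eventually.of_forall fun i => by rw [abs_of_pos (hr0 i)]; exact hrR i
  have hrib : ∀ᶠ i in (U : Filter ι), |(r i)⁻¹| ≤ c⁻¹ :=
    Eventually.of_forall fun i => by
      rw [abs_of_pos (inv_pos.2 (hr0 i))]; exact inv_anti₀ hc (hcr i)
  have haF : Tendsto (fun i => a i • F (z i)) U (𝓝 0) := by
    refine squeeze_zero_norm' (a := fun i => ‖a i‖ * (‖F u‖ + L * M)) ?_
      (by simpa using ha.norm.mul_const (‖F u‖ + L * M))
    filter_upwards [hM] with i hi
    rw [norm_smul]
    exact mul_le_mul_of_nonneg_left (norm_le_of_lipschitzWith hFL hi) (norm_nonneg _)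
  have hAb : Tendsto (fun i => ContinuousLinearMap.adjoint A (residual A g₁ g₂ (r i) (z i))) U
      (𝓝 0) := by
    have h := ((ContinuousLinearMap.adjoint A).continuous.tendsto 0).comp hb
    rwa [map_zero] at h
  have hY : Tendsto (fun i => forwardDiff A e₂ g₁ g₂ F (r i) (a i) (z i) u - (z i - u)) U
      (𝓝 0) := by
    have h := tendsto_smul_zero_of_bounded hrb
      (by simpa using ((hp.add hAb).add haF).neg)
    refine h.congr fun i => ?_
    rw [forwardDiff, forwardPoint]
    module
  have hzz : Tendsto (fun i => step A e₁ e₂ g₁ g₂ F (r i) (a i) (z i) - z i) U (𝓝 0) := by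
    have h := hY.sub hd
    simp only [sub_zero] at h
    refine h.congr fun i => ?_
    abel
  refine ⟨w, ⟨fun y => ?_, fun y => ?_⟩, ?_⟩
  · have hs : Tendsto (fun i => -((r i)⁻¹ • (step A e₁ e₂ g₁ g₂ F (r i) (a i) (z i) - z i))
        - ContinuousLinearMap.adjoint A (residual A g₁ g₂ (r i) (z i)) - a i • F (z i)) U
        (𝓝 0) := by
      simpa using ((tendsto_smul_zero_of_bounded hrib hzz).neg.sub hAb).sub haF
    refine isMinimizer_of_weak_limit he₁ he₂ he₂' hw hzM
      (hM.mono fun i hi => norm_le_of_lipschitzWith he₂L hi) hzz hs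
      (Eventually.of_forall fun i => ?_) y
    obtain ⟨β, hβ, hβ'⟩ : IsResolventPoint (subdifferential e₁) (r i)
      (forwardPoint A e₂ g₁ g₂ F (r i) (a i) (z i)) (step A e₁ e₂ g₁ g₂ F (r i) (a i) (z i)) :=
      he₁.isResolventPoint_resolventMap (hr0 i) _
    convert hβ using 1
    apply smul_right_injective H₁ (hr0 i).ne'
    simp only [smul_sub, smul_neg, smul_smul, mul_inv_cancel₀ (hr0 i).ne', one_smul]
    rw [eq_sub_of_add_eq' hβ', forwardPoint]
    module
  · have hw' : ∀ y, Tendsto (fun i => ⟪A (z i), y⟫_ℝ) U (𝓝 ⟪A w, y⟫_ℝ) := by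
      intro y
      simp only [← ContinuousLinearMap.adjoint_inner_right]
      exact hw _
    have htv : Tendsto (fun i => resolventMap (subdifferential g₁) (r i)
        (A (z i) - r i • ∇ g₂ (A (z i))) - A (z i)) U (𝓝 0) := by
      have h := hb.neg
      rw [neg_zero] at h
      refine h.congr fun i => ?_
      rw [residual, neg_sub]
    have hs := tendsto_smul_zero_of_bounded hrib hb
    refine isMinimizer_of_weak_limit hg₁ hg₂ hg₂' hw' (M := ‖A u‖ + ‖A‖ * M) ?_
      (hAM.mono fun i hi => norm_le_of_lipschitzWith hg₂L hi) htv hs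
      (Eventually.of_forall fun i => ?_) y
    · filter_upwards [hAM] with i hi
      linarith [norm_le_norm_add_norm_sub' (A (z i)) (A u)]
    obtain ⟨β, hβ, hβ'⟩ := hg₁.isResolventPoint_resolventMap (hr0 i)
      (A (z i) - r i • ∇ g₂ (A (z i)))
    convert hβ using 1
    apply smul_right_injective H₂ (hr0 i).ne'
    simp only [smul_sub, smul_smul, mul_inv_cancel₀ (hr0 i).ne', one_smul]
    rw [eq_sub_of_add_eq' hβ', residual]
    module
  · have h1 := (tendsto_const_nhds (x := x)).inner (𝕜 := ℝ) hY
    have h2 := (hw x).sub_const ⟪u, x⟫_ℝ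
    have h3 := h1.add h2
    rw [inner_zero_right, zero_add, ← inner_sub_left, real_inner_comm x (w - u)] at h3
    refine h3.congr fun i => ?_
    rw [← inner_sub_left, real_inner_comm x (z i - u), ← inner_add_right, sub_add_cancel]

end Limit

/-! ### Strong convergence -/

section Convergence

variable {H₁ H₂ : Type*}
  [NormedAddCommGroup H₁] [InnerProductSpace ℝ H₁] [CompleteSpace H₁]
  [NormedAddCommGroup H₂] [InnerProductSpace ℝ H₂] [CompleteSpace H₂]
  {A : H₁ →L[ℝ] H₂} {e₁ : H₁ → EReal} {g₁ : H₂ → EReal} {e₂ : H₁ → ℝ} {g₂ : H₂ → ℝ}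
  {F : H₁ → H₁}

/-- The solution set is closed and convex, so the variational inequality over it is solvable. -/
lemma exists_variationalInequality_solutionSet (he₁ : IsProperLscConvex e₁)
    (hg₁ : IsProperLscConvex g₁)
    (he₂ : ConvexOn ℝ Set.univ e₂) (he₂' : Differentiable ℝ e₂)
    (hg₂ : ConvexOn ℝ Set.univ g₂) (hg₂' : Differentiable ℝ g₂)
    (hce : Continuous (∇ e₂)) (hcg : Continuous (∇ g₂))
    {γ : ℝ} {L : ℝ≥0} (hF : IsStronglyMonotone F γ) (hFL : LipschitzWith L F)
    (hne : (solutionSet A e₁ e₂ g₁ g₂).Nonempty) :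
    ∃ u ∈ solutionSet A e₁ e₂ g₁ g₂, ∀ x ∈ solutionSet A e₁ e₂ g₁ g₂, 0 ≤ ⟪F u, x - u⟫_ℝ := by
  refine exists_variationalInequality hne ?_ ?_ hF hFL
  · exact (isClosed_minimizers he₁ he₂ he₂' hce).inter
      ((isClosed_minimizers hg₁ hg₂ hg₂' hcg).preimage A.continuous)
  · exact (convex_minimizers he₁ he₂).inter
      ((convex_minimizers hg₁ hg₂).linear_preimage A.toLinearMap)

/-- Strong convergence for step sizes that stay between a positive constant and
`1 / (2 max (L₁, L₂, ‖A‖²))`, and regularization parameters that tend to zero with divergent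
sum. -/
theorem tendsto_of_step (he₁ : IsProperLscConvex e₁) (hg₁ : IsProperLscConvex g₁)
    (he₂ : ConvexOn ℝ Set.univ e₂) (he₂' : Differentiable ℝ e₂)
    (hg₂ : ConvexOn ℝ Set.univ g₂) (hg₂' : Differentiable ℝ g₂)
    {L₁ L₂ L : ℝ≥0} (hL₁ : 0 < L₁) (hL₂ : 0 < L₂)
    (he₂L : LipschitzWith L₁ (∇ e₂)) (hg₂L : LipschitzWith L₂ (∇ g₂))
    {γ : ℝ} (hF : IsStronglyMonotone F γ) (hFL : LipschitzWith L F)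
    {a r : ℕ → ℝ} (ha : ∀ n, 0 < a n) (ha_lim : Tendsto a atTop (𝓝 0))
    (ha_sum : Tendsto (fun N => ∑ n ∈ Finset.range N, a n) atTop atTop)
    {c : ℝ} (hc : 0 < c) (hcr : ∀ n, c ≤ r n) (hrL₁ : ∀ n, r n * L₁ ≤ 1 / 2)
    (hrL₂ : ∀ n, r n * L₂ ≤ 1 / 2) (hrA : ∀ n, r n * ‖A‖ ^ 2 ≤ 1 / 2)
    {z : ℕ → H₁} (hz : ∀ n, z (n + 1) = step A e₁ e₂ g₁ g₂ F (r n) (a n) (z n))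
    {u : H₁} (hu : u ∈ solutionSet A e₁ e₂ g₁ g₂)
    (hu' : ∀ x ∈ solutionSet A e₁ e₂ g₁ g₂, 0 ≤ ⟪F u, x - u⟫_ℝ) :
    Tendsto z atTop (𝓝 u) := by
  have hγ := hF.1
  have hL₁' : (0 : ℝ) < L₁ := hL₁
  have hr0 : ∀ n, 0 < r n := fun n => hc.trans_le (hcr n)
  have hrR : ∀ n, r n ≤ 1 / (2 * L₁) := fun n => by
    rw [le_div_iff₀ (by positivity)]; linarith [hrL₁ n]
  have hra : ∀ n, 0 < r n * a n := fun n => mul_pos (hr0 n) (ha n)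
  have hra_lim : Tendsto (fun n => r n * a n) atTop (𝓝 0) := by
    refine squeeze_zero (g := fun n => 1 / (2 * L₁) * a n) (fun n => (hra n).le)
      (fun n => mul_le_mul_of_nonneg_right (hrR n) (ha n).le) ?_
    simpa using ha_lim.const_mul (1 / (2 * (L₁ : ℝ)))
  set Y : ℕ → H₁ := fun n => forwardDiff A e₂ g₁ g₂ F (r n) (a n) (z n) u with hY
  set E : ℕ → ℝ := fun n => r n / (2 * L₁) * ‖∇ e₂ (z n) - ∇ e₂ u‖ ^ 2
    + r n / 4 * ‖residual A g₁ g₂ (r n) (z n)‖ ^ 2 with hE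
  have hE0 : ∀ n, 0 ≤ E n := fun n => by
    have := hr0 n
    positivity
  have hlast : ∀ n, ‖z (n + 1) - u‖ ^ 2 + ‖Y n - (z (n + 1) - u)‖ ^ 2 ≤ ‖Y n‖ ^ 2 := fun n => by
    rw [hz n]
    exact step_sub_norm_sq_le he₁ he₂' (hr0 n) hu (z n)
  have hsmall : ∀ᶠ n in atTop, 3 * (r n * a n) * (L : ℝ) ^ 2 ≤ γ := by
    have h : Tendsto (fun n => 3 * (r n * a n) * (L : ℝ) ^ 2) atTop (𝓝 0) := by
      simpa using (hra_lim.const_mul 3).mul_const ((L : ℝ) ^ 2)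
    exact h.eventually_le_const hγ
  have hone : ∀ᶠ n in atTop, r n * a n * γ ≤ 1 := by
    have h : Tendsto (fun n => r n * a n * γ) atTop (𝓝 0) := by
      simpa using hra_lim.mul_const γ
    exact h.eventually_le_const one_pos
  have hW : ∀ᶠ n in atTop,
      ‖Y n + (r n * a n) • F u‖ ^ 2 ≤ (1 - r n * a n * γ) * ‖z n - u‖ ^ 2 - E n := by
    filter_upwards [hsmall] with n hn
    have := forwardDiff_norm_sq_le hg₁ he₂ he₂' hg₂ hg₂' hL₁ hL₂ he₂L hg₂L hF hFL (hr0 n) (ha n).le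
      (hrL₁ n) (hrL₂ n) (hrA n) hn hu (z n)
    simp only [hE]
    linarith
  -- the iterates and the deviations `Y n` are bounded
  obtain ⟨M, hM⟩ : ∃ M : ℝ, ∀ᶠ n in atTop, ‖z n - u‖ ≤ M ∧ ‖Y n‖ ≤ M := by
    have hYle : ∀ᶠ n in atTop, ‖Y n‖ ≤
        (1 - r n * a n * γ / 2) * ‖z n - u‖ + r n * a n * γ / 2 * (2 * ‖F u‖ / γ) := by
      filter_upwards [hW, hone] with n hn h1
      have h2 : ‖Y n + (r n * a n) • F u‖ ≤ (1 - r n * a n * γ / 2) * ‖z n - u‖ := by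
        refine (abs_le_of_sq_le_sq' ?_ (mul_nonneg (by linarith) (norm_nonneg _))).2
        rw [mul_pow]
        nlinarith [hE0 n, mul_nonneg (sq_nonneg (r n * a n * γ)) (sq_nonneg ‖z n - u‖)]
      have h3 := norm_sub_le (Y n + (r n * a n) • F u) ((r n * a n) • F u)
      rw [add_sub_cancel_right, norm_smul, Real.norm_of_nonneg (hra n).le] at h3
      have h4 : r n * a n * γ / 2 * (2 * ‖F u‖ / γ) = r n * a n * ‖F u‖ := by
        field_simp
      linarith
    obtain ⟨N, hN⟩ := eventually_atTop.1 (hYle.and hone)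
    set M := max ‖z N - u‖ (2 * ‖F u‖ / γ) with hMdef
    have hstep : ∀ n, N ≤ n → ‖z n - u‖ ≤ M → ‖Y n‖ ≤ M := by
      intro n hn hzn
      obtain ⟨h1, h2⟩ := hN n hn
      have hτ : 0 ≤ r n * a n * γ / 2 := by have := hra n; positivity
      have h3 := mul_le_mul_of_nonneg_left hzn (show 0 ≤ 1 - r n * a n * γ / 2 by linarith)
      have h4 := mul_le_mul_of_nonneg_left (le_max_right ‖z N - u‖ (2 * ‖F u‖ / γ)) hτ
      rw [← hMdef] at h4
      linarith
    have hzM : ∀ n, N ≤ n → ‖z n - u‖ ≤ M := by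
      intro n hn
      induction n, hn using Nat.le_induction with
      | base => exact le_max_left _ _
      | succ n hn ih =>
        refine le_trans ?_ (hstep n hn ih)
        refine (abs_le_of_sq_le_sq' ?_ (norm_nonneg _)).2
        linarith [hlast n, sq_nonneg ‖Y n - (z (n + 1) - u)‖]
    exact ⟨M, eventually_atTop.2 ⟨N, fun n hn => ⟨hzM n hn, hstep n hn (hzM n hn)⟩⟩⟩
  have hrec : ∀ᶠ n in atTop, ‖z (n + 1) - u‖ ^ 2 + (E n + ‖Y n - (z (n + 1) - u)‖ ^ 2)
      ≤ (1 - r n * a n * γ) * ‖z n - u‖ ^ 2 - 2 * (r n * a n) * ⟪F u, Y n⟫_ℝ := by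
    filter_upwards [hW] with n hn
    have h1 := norm_add_sq_real (Y n) ((r n * a n) • F u)
    rw [real_inner_smul_right, real_inner_comm] at h1
    linarith [hlast n, sq_nonneg ‖(r n * a n) • F u‖]
  have hs : Tendsto (fun n => ‖z n - u‖ ^ 2) atTop (𝓝 0) := by
    refine tendsto_zero_of_recursive_le (t := fun n => r n * a n * γ) (fun n => sq_nonneg _)
      hone ?_ ?_
    · refine tendsto_atTop_mono (f := fun N => c * γ * ∑ n ∈ Finset.range N, a n) (fun N => ?_)
        (ha_sum.const_mul_atTop (by positivity))
      rw [Finset.mul_sum]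
      refine Finset.sum_le_sum fun n _ => ?_
      have := mul_le_mul_of_nonneg_right (hcr n) (mul_pos (ha n) hγ).le
      linarith
    -- If the recursion with error `ε` fails infinitely often, then along an ultrafilter the
    -- residual terms are `O(r n * a n)`, hence vanish, and the variational inequality at a weak
    -- limit contradicts `ε > 0`.
    intro ε hε
    by_contra hcon
    rw [not_eventually] at hcon
    have : (atTop ⊓ 𝓟 {n | ¬‖z (n + 1) - u‖ ^ 2
        ≤ (1 - r n * a n * γ) * ‖z n - u‖ ^ 2 + r n * a n * γ * ε}).NeBot :=
      frequently_mem_iff_neBot.1 hcon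
    set U := Ultrafilter.of (atTop ⊓ 𝓟 {n | ¬‖z (n + 1) - u‖ ^ 2
        ≤ (1 - r n * a n * γ) * ‖z n - u‖ ^ 2 + r n * a n * γ * ε}) with hU
    have hUle := Ultrafilter.of_le (atTop ⊓ 𝓟 {n | ¬‖z (n + 1) - u‖ ^ 2
        ≤ (1 - r n * a n * γ) * ‖z n - u‖ ^ 2 + r n * a n * γ * ε})
    rw [← hU] at hUle
    have hUtop : (U : Filter ℕ) ≤ atTop := hUle.trans inf_le_left
    have hbad : ∀ᶠ n in (U : Filter ℕ),
        r n * a n * γ * ε + (E n + ‖Y n - (z (n + 1) - u)‖ ^ 2)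
          ≤ -(2 * (r n * a n) * ⟪F u, Y n⟫_ℝ) := by
      have h1 : ∀ᶠ n in (U : Filter ℕ), ¬‖z (n + 1) - u‖ ^ 2
          ≤ (1 - r n * a n * γ) * ‖z n - u‖ ^ 2 + r n * a n * γ * ε :=
        le_principal_iff.1 (hUle.trans inf_le_right)
      filter_upwards [h1, hUtop hrec] with n hn hn'
      linarith
    have hvan : ∀ᶠ n in (U : Filter ℕ),
        E n + ‖Y n - (z (n + 1) - u)‖ ^ 2 ≤ 2 * (‖F u‖ * M) * (r n * a n) := by
      filter_upwards [hbad, hUtop hM] with n hn hMn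
      have h1 := neg_le_of_abs_le (abs_real_inner_le_norm (F u) (Y n))
      have h2 := mul_le_mul_of_nonneg_left hMn.2 (norm_nonneg (F u))
      have h3 := mul_le_mul_of_nonneg_left (show -⟪F u, Y n⟫_ℝ ≤ ‖F u‖ * M by linarith)
        (show 0 ≤ 2 * (r n * a n) by linarith [hra n])
      have h4 : 0 ≤ r n * a n * γ * ε := by have := hra n; positivity
      linarith
    have hlimU : Tendsto (fun n => 2 * (‖F u‖ * M) * (r n * a n)) U (𝓝 0) := by
      simpa using (hra_lim.mono_left hUtop).const_mul (2 * (‖F u‖ * M))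
    have hp : Tendsto (fun n => ∇ e₂ (z n) - ∇ e₂ u) U (𝓝 0) := by
      refine tendsto_zero_of_mul_norm_sq_le (K := c / (2 * L₁)) (by positivity) hlimU ?_
      filter_upwards [hvan] with n hn
      refine le_trans ?_ hn
      have h1 : c / (2 * L₁) * ‖∇ e₂ (z n) - ∇ e₂ u‖ ^ 2
          ≤ r n / (2 * L₁) * ‖∇ e₂ (z n) - ∇ e₂ u‖ ^ 2 := by
        gcongr; exact hcr n
      have h2 : 0 ≤ r n / 4 * ‖residual A g₁ g₂ (r n) (z n)‖ ^ 2 := by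
        have := hr0 n
        positivity
      simp only [hE]
      linarith [sq_nonneg ‖Y n - (z (n + 1) - u)‖]
    have hb : Tendsto (fun n => residual A g₁ g₂ (r n) (z n)) U (𝓝 0) := by
      refine tendsto_zero_of_mul_norm_sq_le (K := c / 4) (by positivity) hlimU ?_
      filter_upwards [hvan] with n hn
      refine le_trans ?_ hn
      have h1 : c / 4 * ‖residual A g₁ g₂ (r n) (z n)‖ ^ 2
          ≤ r n / 4 * ‖residual A g₁ g₂ (r n) (z n)‖ ^ 2 := by
        gcongr; exact hcr n
      have h2 : 0 ≤ r n / (2 * L₁) * ‖∇ e₂ (z n) - ∇ e₂ u‖ ^ 2 := by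
        have := hr0 n
        positivity
      simp only [hE]
      linarith [sq_nonneg ‖Y n - (z (n + 1) - u)‖]
    have hd : Tendsto (fun n => Y n - (step A e₁ e₂ g₁ g₂ F (r n) (a n) (z n) - u)) U (𝓝 0) := by
      refine tendsto_zero_of_mul_norm_sq_le (K := 1) one_pos hlimU ?_
      filter_upwards [hvan] with n hn
      rw [← hz n, one_mul]
      linarith [hE0 n]
    obtain ⟨w, hw, hlim⟩ := exists_mem_solutionSet_tendsto_inner he₁ hg₁ he₂ he₂' hg₂ hg₂' he₂L hg₂L
      hFL U hc hcr hrR (ha_lim.mono_left hUtop) (hUtop (hM.mono fun n hn => hn.1)) hp hb hd (F u)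
    have hneg : ∀ᶠ n in (U : Filter ℕ), ⟪F u, Y n⟫_ℝ ≤ -(γ * ε / 2) := by
      filter_upwards [hbad] with n hn
      have h1 : r n * a n * (γ * ε + 2 * ⟪F u, Y n⟫_ℝ) ≤ 0 := by
        linarith [hE0 n, sq_nonneg ‖Y n - (z (n + 1) - u)‖]
      linarith [nonpos_of_mul_nonpos_right h1 (hra n)]
    have h1 := le_of_tendsto hlim hneg
    have h2 := hu' w hw
    have h3 : 0 < γ * ε := by positivity
    linarith
  rw [tendsto_iff_norm_sub_tendsto_zero]
  simpa using hs.sqrt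

end Convergence

end SplitMin

theorem mainTheorem6 {H₁ H₂ : Type*}
    [NormedAddCommGroup H₁] [InnerProductSpace ℝ H₁] [CompleteSpace H₁]
    [NormedAddCommGroup H₂] [InnerProductSpace ℝ H₂] [CompleteSpace H₂]
    (A : H₁ →L[ℝ] H₂)
    (e₁ : H₁ → EReal) (he₁ : SplitMin.IsProperLscConvex e₁)
    (g₁ : H₂ → EReal) (hg₁ : SplitMin.IsProperLscConvex g₁)
    (e₂ : H₁ → ℝ) (he₂ : ConvexOn ℝ Set.univ e₂) (he₂' : Differentiable ℝ e₂)
    (g₂ : H₂ → ℝ) (hg₂ : ConvexOn ℝ Set.univ g₂) (hg₂' : Differentiable ℝ g₂)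
    (L₁ L₂ : ℝ≥0) (hL₁ : 0 < L₁) (hL₂ : 0 < L₂)
    (he₂L : LipschitzWith L₁ (∇ e₂)) (hg₂L : LipschitzWith L₂ (∇ g₂))
    (F : H₁ → H₁) (γ : ℝ) (hFmono : SplitMin.IsStronglyMonotone F γ)
    (L : ℝ≥0) (hFlip : LipschitzWith L F)
    (hΩ : (SplitMin.solutionSet A e₁ e₂ g₁ g₂).Nonempty)
    (α lam : ℕ → ℝ)
    (hα : ∀ n, 0 < α n ∧ α n < 1)
    (hα_lim : Tendsto α atTop (𝓝 0))
    (hα_sum : Tendsto (fun N => ∑ n ∈ Finset.range N, α n) atTop atTop)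
    (hα_diff : Tendsto (fun n => |α (n + 1) - α n| / α n ^ 2) atTop (𝓝 0))
    (c ρ : ℝ) (hc : 0 < c) (hρ : 2 < ρ)
    (hlam : ∀ n, c < lam n ∧ lam n < 1 / ρ * min (1 / (L₁ : ℝ)) (1 / (L₂ : ℝ)) ∧
      (A ≠ 0 → lam n < 1 / ρ * (1 / ‖A‖ ^ 2)))
    (z : ℕ → H₁)
    (hz : ∀ n, z (n + 1) = SplitMin.step A e₁ e₂ g₁ g₂ F (lam n) (α n) (z n)) :
    (∀ n x, ∃! p, SplitMin.IsResolventPoint (SplitMin.subdifferential e₁) (lam n) x p) ∧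
    (∀ n y, ∃! q, SplitMin.IsResolventPoint (SplitMin.subdifferential g₁) (lam n) y q) ∧
    ∃ u ∈ SplitMin.solutionSet A e₁ e₂ g₁ g₂,
      (∀ x ∈ SplitMin.solutionSet A e₁ e₂ g₁ g₂, 0 ≤ ⟪F u, x - u⟫_ℝ) ∧
      (∀ v ∈ SplitMin.solutionSet A e₁ e₂ g₁ g₂,
        (∀ x ∈ SplitMin.solutionSet A e₁ e₂ g₁ g₂, 0 ≤ ⟪F v, x - v⟫_ℝ) → v = u) ∧
      Tendsto z atTop (𝓝 u) := by
  have hL₁' : (0 : ℝ) < L₁ := hL₁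
  have hL₂' : (0 : ℝ) < L₂ := hL₂
  have hρ' : 1 / ρ ≤ 1 / 2 := one_div_le_one_div_of_le two_pos hρ.le
  have hρ0 : 0 ≤ 1 / ρ := by positivity
  have hlam0 : ∀ n, 0 < lam n := fun n => hc.trans (hlam n).1
  have hlamK : ∀ n {K : ℝ}, 0 < K → lam n < 1 / ρ * (1 / K) → lam n * K ≤ 1 / 2 := by
    intro n K hK h
    rw [mul_one_div, lt_div_iff₀ hK] at h
    linarith
  have hlamA : ∀ n, lam n * ‖A‖ ^ 2 ≤ 1 / 2 := by
    intro n
    by_cases hA : A = 0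
    · simp [hA]
    · exact hlamK n (pow_pos (norm_pos_iff.2 hA) 2) ((hlam n).2.2 hA)
  refine ⟨fun n x => he₁.existsUnique_isResolventPoint (hlam0 n) x,
    fun n y => hg₁.existsUnique_isResolventPoint (hlam0 n) y, ?_⟩
  obtain ⟨u, hu, hu'⟩ := SplitMin.exists_variationalInequality_solutionSet he₁ hg₁ he₂ he₂' hg₂ hg₂'
    he₂L.continuous hg₂L.continuous hFmono hFlip hΩ
  refine ⟨u, hu, hu', fun v hv hv' =>
    SplitMin.variationalInequality_unique hFmono hu hv hu' hv', ?_⟩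
  refine SplitMin.tendsto_of_step he₁ hg₁ he₂ he₂' hg₂ hg₂' hL₁ hL₂ he₂L hg₂L hFmono hFlip
    (fun n => (hα n).1) hα_lim hα_sum hc (fun n => (hlam n).1.le) (fun n => ?_) (fun n => ?_) hlamA
    hz hu hu'
  · exact hlamK n hL₁' ((hlam n).2.1.trans_le (mul_le_mul_of_nonneg_left (min_le_left _ _) hρ0))
  · exact hlamK n hL₂' ((hlam n).2.1.trans_le (mul_le_mul_of_nonneg_left (min_le_right _ _) hρ0))
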